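/- All Hilbert spaces are finite-dimensional, states are normalized density operators, and $\log=\log_2$. For states $\rho,\sigma$ let $F(\rho,\sigma)=\|\sqrt\rho\sqrt\sigma\|_1$, $P(\rho,\sigma)=\sqrt{1-F(\rho,\sigma)^2}$ and $\mathcal B^{\varepsilon}(\rho)=\{\rho' \text{ a state}: P(\rho,\rho')\le\varepsilon\}$. Let $$D_H^{\varepsilon}(\rho\|\sigma)=\sup_{0\le\Pi\le I,\ \mathrm{Tr}(\Pi\rho)\ge 1-\varepsilon^2}\log\frac1{\mathrm{Tr}(\Pi\sigma)},\qquad D_{\max}(\rho\|\sigma)=\inf\{\lambda\in\mathbb R:\rho\le 2^{\lambda}\sigma\},$$ $$\tilde I_{\max}^{\varepsilon}(X:Y)_\rho=\inf_{\rho'\in\mathcal B^{\varepsilon}(\rho_{XY})}D_{\max}(\rho'_{XY}\|\rho'_X\otimes\rho_Y).$$ Let $\mathcal N_{AS\to B}$ be a quantum channel (a completely positive trace-preserving map) and let $\phi_{SS'}$ be a pure state, whose register $S$ is held by the channel and $S'$ by the sender, Alice. For $R\ge 0$, an $(R,\eta)$-entanglement-assisted code consists of a pure state $\theta_{E_AE_B}$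 shared by Alice and the receiver Bob, an encoding channel $\mathcal E: ME_AS'\to A$ and a decoding channel $\mathcal D: BE_B\to M'$, where $M\equiv M'$ is a register with orthonormal basis indexed by the messages $m\in[1:2^R]=\{1,\dots,\lfloor 2^R\rfloor\}$, such that for every message $m$: if $\mathcal E$, then $\mathcal N_{AS\to B}$, then $\mathcal D$ is applied to $|m\rangle\langle m|_M\otimes\theta_{E_AE_B}\otimes\phi_{SS'}$ and $M'$ is measured in this basis, then $\Pr(M'\ne m\mid M=m)\le\eta^2$. Theorem. Let $\varepsilon,\delta\in(0,1)$. For every real $R\ge 0$ with $$R\le\sup_{\psi_{AA'S}:\ \psi_S=\phi_S}\Big(D_H^{\varepsilon}\big(\mathcal N_{AS\to B}(\psi_{AA'S})\,\big\|\,\mathcal N_{AS\to B}(\psi_{AS})\otimes\psi_{A'}\big)-\tilde I_{\max}^{\varepsilon}(A':S)_\psi\Big)-4\log\frac1\delta,$$ where the supremum is over all finite-dimensional registers $A'$ and all states $\psi_{AA'S}$ whose marginal on $S$ is $\phi_S$, there exists an $(R,6\varepsilon+4\delta)$-entanglement-assisted code for $\mathcal N_{AS\to B}$ and $\phi_{SS'}$;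 that is, every message is decoded wrongly with probability at most $(6\varepsilon+4\delta)^2$. -/

import Mathlib

open scoped Kronecker ComplexOrder

namespace QInfo

noncomputable section

/-! Registers are finite index types: the register `n` carries the Hilbert space `ℂ^n`, operators on
it are matrices `Matrix n n ℂ`, and composition of registers is the product type. All logarithms
have base 2. -/

/-- A quantum state: a positive semidefinite matrix of trace one. -/
def IsState {n : Type*} [Fintype n] (ρ : Matrix n n ℂ) : Prop :=
  ρ.PosSemidef ∧ ρ.trace = 1

/-- A unit vector. -/
def IsKet {n : Type*} [Fintype n] (v : n → ℂ) : Prop :=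
  ∑ i, ‖v i‖ ^ 2 = 1

/-- The rank-one operator `|v⟩⟨v|`. -/
def ketbra {n : Type*} (v : n → ℂ) : Matrix n n ℂ :=
  Matrix.vecMulVec v (star v)

/-- Partial trace over the first register. -/
def traceFst {m n : Type*} [Fintype m] (X : Matrix (m × n) (m × n) ℂ) : Matrix n n ℂ :=
  Matrix.of fun i j => ∑ a, X (a, i) (a, j)

/-- Partial trace over the second register. -/
def traceSnd {m n : Type*} [Fintype n] (X : Matrix (m × n) (m × n) ℂ) : Matrix m m ℂ :=
  Matrix.of fun i j => ∑ a, X (i, a) (j, a)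

/-- The action of `Φ ⊗ id_r` on operators: `Φ` is applied to each block. -/
def ampliate {m n : Type*} (Φ : Matrix m m ℂ →ₗ[ℂ] Matrix n n ℂ) {r : Type*}
    (X : Matrix (m × r) (m × r) ℂ) : Matrix (n × r) (n × r) ℂ :=
  Matrix.of fun p q => Φ (Matrix.of fun a b => X (a, p.2) (b, q.2)) p.1 q.1

/-- A quantum channel: a completely positive trace preserving linear map. -/
structure Channel (m n : Type*) [Fintype m] [Fintype n] where
  toMap : Matrix m m ℂ →ₗ[ℂ] Matrix n n ℂ
  completelyPositive : ∀ (k : ℕ) (X : Matrix (m × Fin k) (m × Fin k) ℂ),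
    X.PosSemidef → (ampliate toMap X).PosSemidef
  tracePreserving : ∀ X : Matrix m m ℂ, (toMap X).trace = X.trace

open scoped MatrixOrder in
/-- The trace norm `‖X‖₁ = Tr √(X† X)`. -/
def traceNorm {n : Type*} [Fintype n] [DecidableEq n] (X : Matrix n n ℂ) : ℝ :=
  (CFC.sqrt (X.conjTranspose * X)).trace.re

open scoped MatrixOrder in
/-- The fidelity `F(ρ, σ) = ‖√ρ √σ‖₁`. -/
def fidelity {n : Type*} [Fintype n] [DecidableEq n] (ρ σ : Matrix n n ℂ) : ℝ :=
  traceNorm (CFC.sqrt ρ * CFC.sqrt σ)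

/-- The purified distance `P(ρ, σ) = √(1 - F(ρ, σ)²)`. -/
def purifiedDistance {n : Type*} [Fintype n] [DecidableEq n] (ρ σ : Matrix n n ℂ) : ℝ :=
  Real.sqrt (1 - fidelity ρ σ ^ 2)

/-- The `ε`-ball of normalized states around `ρ` in purified distance. -/
def ball {n : Type*} [Fintype n] [DecidableEq n] (ε : ℝ) (ρ : Matrix n n ℂ) :
    Set (Matrix n n ℂ) :=
  {ρ' | IsState ρ' ∧ purifiedDistance ρ ρ' ≤ ε}

/-- `log₂ (1 / x)` for `x ≥ 0`, with value `+∞` at `x = 0`. -/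
def logInv (x : ℝ) : EReal :=
  if x = 0 then ⊤ else ((Real.logb 2 (1 / x) : ℝ) : EReal)

/-- The hypothesis testing divergence
`D_H^ε(ρ‖σ) = sup {log₂ (1 / Tr (Π σ)) : 0 ≤ Π ≤ I, Tr (Π ρ) ≥ 1 - ε²}`. -/
def hypothesisTesting {n : Type*} [Fintype n] [DecidableEq n] (ε : ℝ) (ρ σ : Matrix n n ℂ) :
    EReal :=
  ⨆ (T : Matrix n n ℂ) (_ : T.PosSemidef ∧ (1 - T).PosSemidef ∧ 1 - ε ^ 2 ≤ (T * ρ).trace.re),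
    logInv (T * σ).trace.re

/-- The max-relative entropy `D_max(ρ‖σ) = inf {l : ρ ≤ 2^l σ}` (`+∞` if there is no such `l`). -/
def maxRelativeEntropy {n : Type*} (ρ σ : Matrix n n ℂ) : EReal :=
  ⨅ (l : ℝ) (_ : (((2 : ℝ) ^ l) • σ - ρ).PosSemidef), (l : EReal)

/-- The smooth max-information
`Ĩ_max^ε(X:Y)_ρ = inf {D_max(ρ'_{XY} ‖ ρ'_X ⊗ ρ_Y) : ρ' ∈ ball ε ρ_{XY}}`. -/
def smoothMaxInformation {x y : Type*} [Fintype x] [DecidableEq x] [Fintype y] [DecidableEq y]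
    (ε : ℝ) (ρ : Matrix (x × y) (x × y) ℂ) : EReal :=
  ⨅ ρ' ∈ ball ε ρ, maxRelativeEntropy ρ' (traceSnd ρ' ⊗ₖ traceFst ρ)

/-! ### Channels with side information at the encoder -/

/-- The supremum over all finite-dimensional registers `A'` (of dimension `d`) and all states
`ψ_{AA'S}` with `ψ_S = φ_S` of
`D_H^ε(N(ψ_{AA'S}) ‖ N(ψ_{AS}) ⊗ ψ_{A'}) - Ĩ_max^ε(A':S)_ψ`.
Here `ψ` is reordered as `ψ_{ASA'}` before the channel acts on `AS`. -/
def sideInformationRate {A S S' B : Type*} [Fintype A] [DecidableEq A] [Fintype S] [DecidableEq S]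
    [Fintype S'] [Fintype B] [DecidableEq B]
    (N : Channel (A × S) B) (φ : S × S' → ℂ) (ε : ℝ) : EReal :=
  ⨆ (d : ℕ) (ψ : Matrix (A × (Fin d × S)) (A × (Fin d × S)) ℂ)
    (_ : IsState ψ ∧ traceFst (traceFst ψ) = traceSnd (ketbra φ)),
    let ψ_ASA' : Matrix ((A × S) × Fin d) ((A × S) × Fin d) ℂ :=
      ψ.submatrix (fun i => (i.1.1, (i.2, i.1.2))) (fun i => (i.1.1, (i.2, i.1.2)))
    let ψ_AS : Matrix (A × S) (A × S) ℂ := traceSnd ψ_ASA'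
    let ψ_A' : Matrix (Fin d) (Fin d) ℂ := traceFst ψ_ASA'
    let ψ_A'S : Matrix (Fin d × S) (Fin d × S) ℂ := traceFst ψ
    hypothesisTesting ε (ampliate N.toMap ψ_ASA') (N.toMap ψ_AS ⊗ₖ ψ_A')
      - smoothMaxInformation ε ψ_A'S

/-- The message set `[1 : 2^R]`, of `⌊2^R⌋` elements. -/
abbrev Message (R : ℝ) : Type := Fin ⌊(2 : ℝ) ^ R⌋₊

/-- The data of an entanglement assisted code with `R` bits of messages for a channel `AS → B` with
side information `S'` at the encoder: a pure state `θ` on `E_A E_B` shared by the sender and the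
receiver, an encoding operation `M E_A S' → A` and a decoding operation `B E_B → M'`. -/
structure Code (A S' B : Type*) [Fintype A] [Fintype S'] [Fintype B] (R : ℝ) where
  EA : Type
  EB : Type
  fintypeEA : Fintype EA
  fintypeEB : Fintype EB
  θ : EA × EB → ℂ
  isKet_θ : IsKet θ
  enc : Channel (Message R × (EA × S')) A
  dec : Channel (B × EB) (Message R)

attribute [instance] Code.fintypeEA Code.fintypeEB

namespace Code

variable {A S S' B : Type*} [Fintype A] [Fintype S] [Fintype S'] [Fintype B] {R : ℝ}

/-- The state `|m⟩⟨m|_M ⊗ φ_{SS'} ⊗ θ_{E_A E_B}` before encoding, with the registers grouped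
as `(M E_A S')(S E_B)`. -/
def initialState (C : Code A S' B R) (φ : S × S' → ℂ) (m : Message R) :
    Matrix ((Message R × (C.EA × S')) × (S × C.EB)) ((Message R × (C.EA × S')) × (S × C.EB)) ℂ :=
  ketbra fun i => (if i.1.1 = m then 1 else 0) * φ (i.2.1, i.1.2.2) * C.θ (i.1.2.1, i.2.2)

/-- The state of `(AS)E_B` after encoding, which is the input to the channel. -/
def encodedState (C : Code A S' B R) (φ : S × S' → ℂ) (m : Message R) :
    Matrix ((A × S) × C.EB) ((A × S) × C.EB) ℂ :=
  (ampliate C.enc.toMap (C.initialState φ m)).submatrix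
    (fun i => (i.1.1, (i.1.2, i.2))) (fun i => (i.1.1, (i.1.2, i.2)))

/-- The state of `M'` after the channel `N : AS → B` and the decoding. -/
def outputState (C : Code A S' B R) (N : Channel (A × S) B) (φ : S × S' → ℂ) (m : Message R) :
    Matrix (Message R) (Message R) ℂ :=
  C.dec.toMap (ampliate N.toMap (C.encodedState φ m))

/-- `Pr(M' ≠ m | M = m)`, where `M'` is read in the computational basis. -/
def errorProb (C : Code A S' B R) (N : Channel (A × S) B) (φ : S × S' → ℂ) (m : Message R) : ℝ :=
  ∑ m' with m' ≠ m, (C.outputState N φ m m' m').re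

end Code

/-- `C` is an `(R, η)`-entanglement assisted code for `N : AS → B` with side information
`φ_{SS'}`: each message is decoded wrongly with probability at most `η²`. -/
def IsCode {A S S' B : Type*} [Fintype A] [Fintype S] [Fintype S'] [Fintype B] {R : ℝ}
    (N : Channel (A × S) B) (φ : S × S' → ℂ) (C : Code A S' B R) (η : ℝ) : Prop :=
  ∀ m : Message R, C.errorProb N φ m ≤ η ^ 2

end

end QInfo

/-!
The code combines position-based decoding with a purified convex split.

Sender and receiver share one purified copy of `σ = ψ_{A'}` for each pair `(m, j)` of a message `m`
and an index `j` in a block of `n` copies. To send `m`, the sender acts on the purifications and on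
`S'` so that the joint state of `S` and the receiver's copies becomes purified by (nearly) the
uniform mixture over `j` of the states in which `ψ_{A A' S}` occupies `S` and the copy `(m, j)`,
including the channel input `A`. The receiver determines the position `(m, j)` by the pretty good
measurement built from the optimal test of `N(ψ_{A A' S})` against `N(ψ_{A S}) ⊗ ψ_{A'}`
(`exists_positionDecoder`); by the Hayashi–Nagaoka inequality (`one_sub_pinv_sqrt_conj_le`) it errs
with probability at most `2 ε² + 4 (number of copies) 2^{-D_H}`.

The sender's isometry exists because purifications with equal marginals differ by a unitary on the
purifying register (`exists_unitary_of_mul_conjTranspose_eq`), once the product state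
`ψ_S ⊗ σ^{⊗ι}` is known to be close to the mixture. Vectors of `Q ⊗ L` are written as matrices
`X : Matrix Q L ℂ`, so that the marginal on `Q` is `X Xᴴ` and distances are Hilbert–Schmidt
distances; `Near` is distance up to a unitary on `L`. The closeness is the convex-split lemma
`hsSq_sqrt_convexSplit_sub_le`: if `ρ ≤ K ψ_S ⊗ σ`, the mixture `τ` and `ω = ρ_S ⊗ σ^{⊗ι}` satisfy
`‖√τ - √ω‖² ≤ K / n`. Indeed `τ - ω = ω^{1/4} Z ω^{1/4}`, where `Z` is an average of `n` pairwise
orthogonal operators of squared norm at most `K`, and `‖√τ - √ω‖² ≤ Tr Z²`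
(`hsSq_sub_le_of_sub_eq`).

The smooth max-information provides `ρ'` near `ψ_{A'S}` with `ρ' ≤ 2^l ρ'_{A'} ⊗ ψ_S`, where the
marginal is `ρ'_{A'}` and not the `ψ_{A'}` which the test of the receiver refers to. Since
purifications of the two states are close, `ρ'_{A'} ≤ 3 ψ_{A'} + Δ` with `Tr Δ = O(ε²)`, and an
operator on `A'` removes `Δ` at a cost of order `ε` (`exists_near_purification_le`). The factor `3`
is absorbed by the constants: with `n` about `3 · 2^l / (4 δ²)`, the errors add up to at most
`6 ε + 4 δ` in amplitude, that is, after taking square roots of probabilities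
(`sqrt_le_sqrt_add_hs`).
-/

namespace QInfo

open scoped MatrixOrder
open Matrix

set_option linter.unusedSectionVars false

/-! ### Hilbert–Schmidt norm and traces -/

/-- The square of the Hilbert–Schmidt norm of a rectangular matrix. -/
noncomputable def hsSq {m n : Type*} [Fintype m] [Fintype n] (X : Matrix m n ℂ) : ℝ :=
  ∑ i, ∑ j, ‖X i j‖ ^ 2

/-- The Hilbert–Schmidt norm of a rectangular matrix. -/
noncomputable def hs {m n : Type*} [Fintype m] [Fintype n] (X : Matrix m n ℂ) : ℝ :=
  Real.sqrt (hsSq X)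

section Basics

variable {m n l : Type*} [Fintype m] [Fintype n] [Fintype l]

lemma hsSq_nonneg (X : Matrix m n ℂ) : 0 ≤ hsSq X := by
  unfold hsSq; positivity

lemma hs_nonneg (X : Matrix m n ℂ) : 0 ≤ hs X := Real.sqrt_nonneg _

lemma hs_sq (X : Matrix m n ℂ) : hs X ^ 2 = hsSq X := Real.sq_sqrt (hsSq_nonneg X)

lemma hs_le_of_hsSq_le {X : Matrix m n ℂ} {x : ℝ} (hx : 0 ≤ x) (h : hsSq X ≤ x ^ 2) :
    hs X ≤ x := Real.sqrt_le_iff.2 ⟨hx, h⟩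

lemma trace_mul_conjTranspose_eq_hsSq (X : Matrix m n ℂ) : (X * Xᴴ).trace = (hsSq X : ℂ) := by
  simp [hsSq, Matrix.trace, Matrix.mul_apply, Complex.mul_conj, Complex.normSq_eq_norm_sq]

lemma hsSq_eq_re_trace (X : Matrix m n ℂ) : hsSq X = (X * Xᴴ).trace.re := by
  rw [trace_mul_conjTranspose_eq_hsSq, Complex.ofReal_re]

lemma hsSq_eq_re_trace' (X : Matrix m n ℂ) : hsSq X = (Xᴴ * X).trace.re := by
  rw [hsSq_eq_re_trace, Matrix.trace_mul_comm]

lemma hsSq_conjTranspose (X : Matrix m n ℂ) : hsSq Xᴴ = hsSq X := by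
  rw [hsSq_eq_re_trace, hsSq_eq_re_trace', conjTranspose_conjTranspose]

lemma hs_conjTranspose (X : Matrix m n ℂ) : hs Xᴴ = hs X := by
  rw [hs, hs, hsSq_conjTranspose]

lemma hs_eq_norm (X : Matrix m n ℂ) : hs X = ‖(WithLp.toLp 2 fun p : m × n => X p.1 p.2)‖ := by
  rw [EuclideanSpace.norm_eq, hs, hsSq]
  simp [Fintype.sum_prod_type]

lemma hs_add_le (X Y : Matrix m n ℂ) : hs (X + Y) ≤ hs X + hs Y := by
  rw [hs_eq_norm, hs_eq_norm, hs_eq_norm]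
  exact norm_add_le (WithLp.toLp 2 fun p : m × n => X p.1 p.2)
    (WithLp.toLp 2 fun p : m × n => Y p.1 p.2)

lemma hs_neg (X : Matrix m n ℂ) : hs (-X) = hs X := by
  simp [hs, hsSq]

lemma hs_sub_comm (X Y : Matrix m n ℂ) : hs (X - Y) = hs (Y - X) := by
  rw [← hs_neg, neg_sub]

lemma hs_sub_le (X Y Z : Matrix m n ℂ) : hs (X - Z) ≤ hs (X - Y) + hs (Y - Z) := by
  simpa using hs_add_le (X - Y) (Y - Z)

lemma hsSq_mul_of_mul_conjTranspose_eq_one [DecidableEq n] (X : Matrix m n ℂ) {E : Matrix n l ℂ}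
    (hE : E * Eᴴ = 1) : hsSq (X * E) = hsSq X := by
  rw [hsSq_eq_re_trace, hsSq_eq_re_trace, conjTranspose_mul, Matrix.mul_assoc,
    ← Matrix.mul_assoc E, hE, Matrix.one_mul]

lemma hs_mul_of_mul_conjTranspose_eq_one [DecidableEq n] (X : Matrix m n ℂ) {E : Matrix n l ℂ}
    (hE : E * Eᴴ = 1) : hs (X * E) = hs X := by
  rw [hs, hs, hsSq_mul_of_mul_conjTranspose_eq_one X hE]

lemma mul_conjTranspose_mul_of_eq_one [DecidableEq n] (X : Matrix m n ℂ) {E : Matrix n l ℂ}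
    (hE : E * Eᴴ = 1) : (X * E) * (X * E)ᴴ = X * Xᴴ := by
  rw [conjTranspose_mul, Matrix.mul_assoc, ← Matrix.mul_assoc E, hE, Matrix.one_mul]

/-- Cauchy–Schwarz for the Hilbert–Schmidt inner product. -/
lemma re_trace_mul_le (X : Matrix m n ℂ) (Y : Matrix n m ℂ) :
    (X * Y).trace.re ≤ hs X * hs Y := by
  rw [← hs_conjTranspose X, hs_eq_norm, hs_eq_norm]
  have h := re_inner_le_norm (𝕜 := ℂ) (WithLp.toLp 2 fun p : n × m => Xᴴ p.1 p.2)
    (WithLp.toLp 2 fun p : n × m => Y p.1 p.2)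
  refine le_trans (le_of_eq ?_) h
  simp only [PiLp.inner_apply, RCLike.inner_apply, Matrix.trace, Matrix.diag, Matrix.mul_apply,
    Fintype.sum_prod_type, conjTranspose_apply]
  rw [Finset.sum_comm]
  simp [mul_comm]

lemma posSemidef_of_nonneg {A : Matrix n n ℂ} (h : 0 ≤ A) : A.PosSemidef :=
  nonneg_iff_posSemidef.1 h

lemma re_trace_nonneg {A : Matrix n n ℂ} (hA : A.PosSemidef) : 0 ≤ A.trace.re :=
  (Complex.le_def.1 hA.trace_nonneg).1

lemma re_trace_mul_nonneg {A B : Matrix n n ℂ} (hA : A.PosSemidef) (hB : B.PosSemidef) :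
    0 ≤ (A * B).trace.re := by
  classical
  obtain ⟨C, rfl⟩ := CStarAlgebra.nonneg_iff_eq_star_mul_self.1 hB.nonneg
  rw [← Matrix.mul_assoc, Matrix.trace_mul_comm, ← Matrix.mul_assoc]
  exact re_trace_nonneg (hA.mul_mul_conjTranspose_same C)

lemma re_trace_mul_le_of_le {A B C : Matrix n n ℂ} (h : A ≤ B) (hC : C.PosSemidef) :
    (A * C).trace.re ≤ (B * C).trace.re := by
  have := re_trace_mul_nonneg (le_iff.1 h) hC
  rw [Matrix.sub_mul, Matrix.trace_sub, Complex.sub_re] at this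
  linarith

lemma re_trace_le_of_le {A B : Matrix n n ℂ} (h : A ≤ B) : A.trace.re ≤ B.trace.re := by
  have := re_trace_nonneg (le_iff.1 h)
  rw [Matrix.trace_sub, Complex.sub_re] at this
  linarith

lemma conj_le_conj {A B : Matrix n n ℂ} (h : A ≤ B) (C : Matrix m n ℂ) :
    C * A * Cᴴ ≤ C * B * Cᴴ := by
  rw [le_iff] at h ⊢
  have := h.mul_mul_conjTranspose_same C
  rwa [Matrix.mul_sub, Matrix.sub_mul] at this

/-- A positive operator annihilated in trace by `C` is annihilated by `C`. -/
lemma mul_eq_zero_of_re_trace_eq_zero {A : Matrix n n ℂ} (hA : A.PosSemidef) {C : Matrix m n ℂ}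
    (h : (C * A * Cᴴ).trace.re ≤ 0) : C * A = 0 := by
  classical
  obtain ⟨D, rfl⟩ := CStarAlgebra.nonneg_iff_eq_star_mul_self.1 hA.nonneg
  have h1 : hsSq (D * Cᴴ) = 0 := by
    refine le_antisymm ?_ (hsSq_nonneg _)
    rw [hsSq_eq_re_trace']
    simpa [conjTranspose_mul, Matrix.mul_assoc, star_eq_conjTranspose] using h
  have h2 : D * Cᴴ = 0 := by
    rw [← Matrix.trace_mul_conjTranspose_self_eq_zero_iff, trace_mul_conjTranspose_eq_hsSq, h1]
    simp
  have h3 : C * Dᴴ = 0 := by simpa using congrArg conjTranspose h2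
  rw [star_eq_conjTranspose, ← Matrix.mul_assoc, h3, Matrix.zero_mul]

/-- The operator form of `‖u‖² ≤ (1 + t) ‖v‖² + (1 + 1/t) ‖u - v‖²`. -/
lemma mul_conjTranspose_le (U V : Matrix m n ℂ) {t : ℝ} (ht : 0 < t) :
    U * Uᴴ ≤ (1 + t) • (V * Vᴴ) + (1 + t⁻¹) • ((U - V) * (U - V)ᴴ) := by
  rw [le_iff]
  have key : (1 + t) • (V * Vᴴ) + (1 + t⁻¹) • ((U - V) * (U - V)ᴴ) - U * Uᴴ =
      t⁻¹ • ((U - V - t • V) * (U - V - t • V)ᴴ) := by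
    have e : t⁻¹ * t = 1 := inv_mul_cancel₀ ht.ne'
    simp only [conjTranspose_sub, conjTranspose_smul, Matrix.sub_mul, Matrix.mul_sub,
      Matrix.smul_mul, Matrix.mul_smul, star_trivial, smul_sub, smul_smul, e, add_smul, one_smul]
    rw [← mul_assoc t⁻¹ t t, e, one_mul]
    abel
  rw [key]
  exact (posSemidef_self_mul_conjTranspose _).smul (inv_nonneg.2 ht.le)

lemma hs_sub_sq (U V : Matrix m n ℂ) :
    hsSq (U - V) = hsSq U + hsSq V - 2 * (U * Vᴴ).trace.re := by
  have h : (V * Uᴴ).trace.re = (U * Vᴴ).trace.re := by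
    have : V * Uᴴ = (U * Vᴴ)ᴴ := by simp
    rw [this, trace_conjTranspose]; simp
  simp only [hsSq_eq_re_trace, conjTranspose_sub, Matrix.sub_mul, Matrix.mul_sub, trace_sub,
    Complex.sub_re, h]
  ring

end Basics

/-! ### Purifications with equal marginals -/

section Gram

variable {Q L : Type*} [Fintype Q] [Fintype L] [DecidableEq L]

/-- Two purifications of the same operator differ by a unitary on the purifying register. -/
theorem exists_unitary_of_mul_conjTranspose_eq {X Y : Matrix Q L ℂ} (h : X * Xᴴ = Y * Yᴴ) :
    ∃ W : Matrix L L ℂ, W * Wᴴ = 1 ∧ X * W = Y := by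
  classical
  let f (Z : Matrix Q L ℂ) : (Q → ℂ) →ₗ[ℂ] EuclideanSpace ℂ L :=
    (WithLp.linearEquiv 2 ℂ (L → ℂ)).symm.toLinearMap ∘ₗ Z.vecMulLinear
  have hf (Z : Matrix Q L ℂ) (c : Q → ℂ) (j : L) : f Z c j = ∑ q, c q * Z q j := by
    simp [f, Matrix.vecMul, dotProduct]
  have hnorm (Z : Matrix Q L ℂ) (c : Q → ℂ) :
      ((‖f Z c‖ ^ 2 : ℝ) : ℂ) = (c ᵥ* (Z * Zᴴ)) ⬝ᵥ star c := by
    have : ((‖f Z c‖ ^ 2 : ℝ) : ℂ) = inner ℂ (f Z c) (f Z c) := by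
      rw [inner_self_eq_norm_sq_to_K]; simp
    rw [this, ← Matrix.vecMul_vecMul, ← Matrix.dotProduct_mulVec]
    have e : Zᴴ *ᵥ star c = star (c ᵥ* Z) := by rw [Matrix.star_vecMul]
    rw [e, EuclideanSpace.inner_eq_star_dotProduct]
    rfl
  have hXY (c : Q → ℂ) : ‖f X c‖ = ‖f Y c‖ := by
    have : ‖f X c‖ ^ 2 = ‖f Y c‖ ^ 2 := by exact_mod_cast (by rw [hnorm, hnorm, h] :
      ((‖f X c‖ ^ 2 : ℝ) : ℂ) = ((‖f Y c‖ ^ 2 : ℝ) : ℂ))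
    exact (pow_left_inj₀ (norm_nonneg _) (norm_nonneg _) two_ne_zero).1 this
  obtain ⟨g, hg⟩ := (f X).rangeRestrict.exists_rightInverse_of_surjective
    (LinearMap.range_rangeRestrict _)
  have hg' (v : LinearMap.range (f X)) : f X (g v) = v := by
    have := LinearMap.congr_fun hg v
    exact congrArg Subtype.val this
  let T : LinearMap.range (f X) →ₗᵢ[ℂ] EuclideanSpace ℂ L :=
    { toLinearMap := f Y ∘ₗ g
      norm_map' := fun v => by
        change ‖f Y (g v)‖ = ‖v‖
        rw [← hXY, hg']; rfl }
  have hT (c : Q → ℂ) : T.extend (f X c) = f Y c := by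
    have h1 := T.extend_apply ⟨f X c, LinearMap.mem_range_self _ c⟩
    rw [h1]
    change f Y (g ⟨f X c, _⟩) = f Y c
    rw [← sub_eq_zero, ← map_sub, ← norm_eq_zero, ← hXY, norm_eq_zero, map_sub, sub_eq_zero, hg']
  let W : Matrix L L ℂ := Matrix.of fun i j => T.extend (EuclideanSpace.single i 1) j
  refine ⟨W, ?_, ?_⟩
  · ext i i'
    have h1 : (W * Wᴴ) i i' =
        inner ℂ (T.extend (EuclideanSpace.single i' 1)) (T.extend (EuclideanSpace.single i 1)) := by
      rw [PiLp.inner_apply]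
      simp [W, Matrix.mul_apply]
    rw [h1, LinearIsometry.inner_map_map]
    simp [Matrix.one_apply, EuclideanSpace.inner_single_left, eq_comm]
  · ext q j
    have h2 := congrArg (fun v : EuclideanSpace ℂ L => v j) (hT (Pi.single q 1))
    have h3 : f X (Pi.single q 1) = ∑ i, X q i • EuclideanSpace.single i (1 : ℂ) := by
      ext k
      simp [hf, Pi.single_apply]
    have h4 : f Y (Pi.single q 1) j = Y q j := by
      simp [hf, Pi.single_apply]
    rw [h3] at h2
    simp only [map_sum, map_smul] at h2
    rw [h4] at h2
    rw [← h2]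
    simp [W, Matrix.mul_apply]

/-- The vectors with coefficient matrices `X` and `Y` in `Q ⊗ L` are within distance `x` of each
other up to a unitary on the purifying register `L`. This only depends on the marginals `X Xᴴ` and
`Y Yᴴ` on `Q`. -/
def Near (x : ℝ) (X Y : Matrix Q L ℂ) : Prop :=
  ∃ W : Matrix L L ℂ, W * Wᴴ = 1 ∧ hs (X * W - Y) ≤ x

lemma Near.trans {x y : ℝ} {X Y Z : Matrix Q L ℂ} (h : Near x X Y) (h' : Near y Y Z) :
    Near (x + y) X Z := by
  obtain ⟨W, hW, hx⟩ := h
  obtain ⟨W', hW', hy⟩ := h'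
  refine ⟨W * W', ?_, ?_⟩
  · rw [mul_conjTranspose_mul_of_eq_one W hW', hW]
  · refine (hs_sub_le _ (Y * W') _).trans (add_le_add ?_ hy)
    rw [← Matrix.mul_assoc, ← Matrix.sub_mul, hs_mul_of_mul_conjTranspose_eq_one _ hW']
    exact hx

lemma Near.of_hs_le {x : ℝ} {X Y : Matrix Q L ℂ} (h : hs (X - Y) ≤ x) : Near x X Y :=
  ⟨1, by simp, by simpa using h⟩

lemma Near.of_eq {X Y : Matrix Q L ℂ} (h : X * Xᴴ = Y * Yᴴ) : Near 0 X Y := by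
  obtain ⟨W, hW, hx⟩ := exists_unitary_of_mul_conjTranspose_eq h
  exact ⟨W, hW, by simp [hx, hs, hsSq]⟩

/-- The isometry that embeds a register along an injection of basis labels. -/
def embedMatrix {G L : Type*} [DecidableEq L] (f : G → L) : Matrix G L ℂ :=
  Matrix.of fun g l => if f g = l then 1 else 0

lemma embedMatrix_mul_conjTranspose {G : Type*} [DecidableEq G] {f : G → L}
    (hf : Function.Injective f) : embedMatrix f * (embedMatrix f)ᴴ = 1 := by
  ext g g'
  simp [embedMatrix, Matrix.mul_apply, Matrix.one_apply, hf.eq_iff, eq_comm]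

end Gram

/-! ### Square roots and pseudo-inverses of positive operators -/

section Roots

variable {n : Type*} [Fintype n] [DecidableEq n]

open scoped Matrix.Norms.L2Operator in
lemma sqrt_le_sqrt_of_le {A B : Matrix n n ℂ} (h : A ≤ B) : CFC.sqrt A ≤ CFC.sqrt B :=
  CFC.sqrt_le_sqrt A B h

lemma posSemidef_sqrt (A : Matrix n n ℂ) : (CFC.sqrt A).PosSemidef :=
  posSemidef_of_nonneg (CFC.sqrt_nonneg A)

lemma conjTranspose_sqrt (A : Matrix n n ℂ) : (CFC.sqrt A)ᴴ = CFC.sqrt A :=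
  (posSemidef_sqrt A).1

lemma sqrt_mul_sqrt {A : Matrix n n ℂ} (hA : A.PosSemidef) : CFC.sqrt A * CFC.sqrt A = A :=
  CFC.sqrt_mul_sqrt_self A hA.nonneg

lemma sqrt_mul_conjTranspose {A : Matrix n n ℂ} (hA : A.PosSemidef) :
    CFC.sqrt A * (CFC.sqrt A)ᴴ = A := by
  rw [conjTranspose_sqrt, sqrt_mul_sqrt hA]

lemma cfc_mul_cfc (A : Matrix n n ℂ) (f g : ℝ → ℝ) :
    cfc f A * cfc g A = cfc (fun x => f x * g x) A := by
  rw [cfc_mul f g A (Matrix.finite_real_spectrum.continuousOn _)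
    (Matrix.finite_real_spectrum.continuousOn _)]

/-- The Moore–Penrose inverse of a positive operator: the inverse on its support and zero on its
kernel. -/
noncomputable def pinv (A : Matrix n n ℂ) : Matrix n n ℂ := cfc (fun x : ℝ => x⁻¹) A

lemma conjTranspose_pinv (A : Matrix n n ℂ) : (pinv A)ᴴ = pinv A :=
  cfc_predicate (p := IsSelfAdjoint) (fun x : ℝ => x⁻¹) A

lemma mul_pinv_eq_cfc {A : Matrix n n ℂ} (hA : A.PosSemidef) :
    A * pinv A = cfc (fun x : ℝ => x * x⁻¹) A := by
  have h : A = cfc id A := (cfc_id ℝ A hA.1).symm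
  conv_lhs => rw [pinv]; enter [1]; rw [h]
  exact cfc_mul_cfc A id _

lemma pinv_mul_comm {A : Matrix n n ℂ} (hA : A.PosSemidef) : pinv A * A = A * pinv A := by
  rw [mul_pinv_eq_cfc hA]
  have h : A = cfc id A := (cfc_id ℝ A hA.1).symm
  conv_lhs => rw [pinv]; enter [2]; rw [h]
  rw [cfc_mul_cfc A]
  simp [mul_comm]

lemma mul_pinv_mul {A : Matrix n n ℂ} (hA : A.PosSemidef) : A * pinv A * A = A := by
  have h : A = cfc id A := (cfc_id ℝ A hA.1).symm
  rw [mul_pinv_eq_cfc hA]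
  conv_lhs => enter [2]; rw [h]
  conv_rhs => rw [h]
  rw [cfc_mul_cfc A]
  congr 1
  ext x
  by_cases hx : x = 0 <;> simp [hx]

lemma mul_pinv_idem {A : Matrix n n ℂ} (hA : A.PosSemidef) :
    A * pinv A * (A * pinv A) = A * pinv A := by
  rw [← Matrix.mul_assoc, mul_pinv_mul hA]

lemma conjTranspose_mul_pinv {A : Matrix n n ℂ} (hA : A.PosSemidef) :
    (A * pinv A)ᴴ = A * pinv A := by
  rw [conjTranspose_mul, conjTranspose_pinv, hA.1, pinv_mul_comm hA]

lemma mul_pinv_le_one {A : Matrix n n ℂ} (hA : A.PosSemidef) : A * pinv A ≤ 1 := by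
  have h : (1 - A * pinv A) = (1 - A * pinv A) * (1 - A * pinv A)ᴴ := by
    rw [conjTranspose_sub, conjTranspose_one, conjTranspose_mul_pinv hA, Matrix.sub_mul,
      Matrix.mul_sub, Matrix.one_mul, Matrix.mul_sub, mul_pinv_idem hA]
    simp
  rw [le_iff, h]
  exact posSemidef_self_mul_conjTranspose _

/-- `P ≤ √P` for `0 ≤ P ≤ 1`. -/
lemma le_sqrt_self {P : Matrix n n ℂ} (hP : P.PosSemidef) (hP1 : P ≤ 1) : P ≤ CFC.sqrt P := by
  set p := CFC.sqrt P with hp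
  have h1 : p ≤ 1 := by simpa using sqrt_le_sqrt_of_le hP1
  have hpp : p * p = P := sqrt_mul_sqrt hP
  have hps : pᴴ = p := conjTranspose_sqrt P
  have hpn : p.PosSemidef := posSemidef_sqrt P
  rw [le_iff]
  have e : p - P = p * (1 - p) * pᴴ + (1 - p) * p * (1 - p)ᴴ := by
    rw [conjTranspose_sub, conjTranspose_one, hps, ← hpp]
    noncomm_ring
  rw [e]
  exact ((le_iff.1 h1).mul_mul_conjTranspose_same p).add (hpn.mul_mul_conjTranspose_same _)

end Roots

/-! ### The Hayashi–Nagaoka inequality -/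

section HayashiNagaoka

variable {n : Type*} [Fintype n] [DecidableEq n]

/-- The Hayashi–Nagaoka inequality: the pretty good measurement operator built from a test `P` and
the sum `S` of all tests fails no more than twice the failure of `P` plus four times the sum of the
competing tests. -/
theorem one_sub_pinv_sqrt_conj_le {P S : Matrix n n ℂ} (hP : P.PosSemidef) (hP1 : P ≤ 1)
    (hPS : P ≤ S) :
    1 - pinv (CFC.sqrt S) * P * pinv (CFC.sqrt S) ≤ (2 : ℝ) • (1 - P) + (4 : ℝ) • (S - P) := by
  have hS : S.PosSemidef := posSemidef_of_nonneg (hP.nonneg.trans hPS)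
  set r := CFC.sqrt S with hr
  have hrp : r.PosSemidef := posSemidef_sqrt S
  have hrr : r * r = S := sqrt_mul_sqrt hS
  set R := pinv r with hR
  have hRs : Rᴴ = R := conjTranspose_pinv r
  set e := r * R with he
  have hRr : R * r = e := pinv_mul_comm hrp
  have her : e * r = r := mul_pinv_mul hrp
  have hee : e * e = e := mul_pinv_idem hrp
  have hre : r * e = r := by rw [← hRr, ← Matrix.mul_assoc]; exact her
  have he1 : e ≤ 1 := mul_pinv_le_one hrp
  have hPr : P ≤ r := (le_sqrt_self hP hP1).trans (sqrt_le_sqrt_of_le hPS)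
  obtain ⟨T, hT⟩ : ∃ T, T = S - P := ⟨_, rfl⟩
  have hTp : T.PosSemidef := hT ▸ le_iff.1 hPS
  have hTS : T ≤ S := by rw [hT, sub_le_self_iff]; exact hP.nonneg
  have hRSR : R * S * R = e := by
    rw [← hrr, ← Matrix.mul_assoc, hRr, Matrix.mul_assoc, ← he, hee]
  have hRS : R * S = r := by rw [← hrr, ← Matrix.mul_assoc, hRr, her]
  have hSR : S * R = r := by rw [← hrr, Matrix.mul_assoc, ← he, hre]
  -- Replacing `R` by `1 + (R - 1)` in `R * T * R` costs a factor two.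
  have h1 : R * T * R ≤ (2 : ℝ) • T + (2 : ℝ) • ((R - 1) * T * (R - 1)) := by
    have := mul_conjTranspose_le (R * CFC.sqrt T) (CFC.sqrt T) (t := 1) one_pos
    have e1 : R * CFC.sqrt T - CFC.sqrt T = (R - 1) * CFC.sqrt T := by
      rw [Matrix.sub_mul, Matrix.one_mul]
    have e2 (X : Matrix n n ℂ) : X * CFC.sqrt T * (X * CFC.sqrt T)ᴴ = X * T * Xᴴ := by
      conv_rhs => rw [← sqrt_mul_sqrt hTp]
      rw [conjTranspose_mul, conjTranspose_sqrt]
      simp only [Matrix.mul_assoc]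
    rw [e1, e2, e2, conjTranspose_sqrt, sqrt_mul_sqrt hTp, conjTranspose_sub, conjTranspose_one,
      hRs] at this
    norm_num at this
    exact this
  have h2 : (R - 1) * T * (R - 1) ≤ (R - 1) * S * (R - 1) := by
    have := conj_le_conj hTS (R - 1)
    rwa [conjTranspose_sub, conjTranspose_one, hRs] at this
  have h3 : (R - 1) * S * (R - 1) = e - (2 : ℝ) • r + S := by
    have : (R - 1) * S * (R - 1) = R * S * R - R * S - S * R + S := by noncomm_ring
    rw [this, hRSR, hRS, hSR, two_smul]
    abel
  have h4 : 1 - R * P * R = 1 - e + R * T * R := by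
    rw [hT, Matrix.mul_sub, Matrix.sub_mul, hRSR]
    abel
  have hsm : ∀ {X Y : Matrix n n ℂ}, X ≤ Y → ∀ c : ℝ, 0 ≤ c → c • X ≤ c • Y := by
    intro X Y hXY c hc
    rw [le_iff, ← smul_sub]
    exact (le_iff.1 hXY).smul hc
  rw [h4, ← hT]
  have hSPT : S = P + T := by rw [hT]; abel
  calc 1 - e + R * T * R
      ≤ 1 - e + ((2 : ℝ) • T + (2 : ℝ) • (e - (2 : ℝ) • r + S)) := by
        rw [← h3]
        exact add_le_add le_rfl (h1.trans (add_le_add le_rfl (hsm h2 2 (by norm_num))))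
    _ = 1 + (2 : ℝ) • T + e - (4 : ℝ) • r + (2 : ℝ) • S := by module
    _ ≤ 1 + (2 : ℝ) • T + 1 - (4 : ℝ) • P + (2 : ℝ) • S :=
        add_le_add (sub_le_sub (add_le_add le_rfl he1) (hsm hPr 4 (by norm_num))) le_rfl
    _ = (2 : ℝ) • (1 - P) + (4 : ℝ) • T := by rw [hSPT]; module

end HayashiNagaoka

/-! ### Fidelity and purifications -/

section Uhlmann

variable {Q L : Type*} [Fintype Q] [Fintype L] [DecidableEq Q] [DecidableEq L]

/-- One direction of Uhlmann's theorem, for a purifying register `L` into which `Q` embeds. -/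
theorem exists_purification_hsSq_sub_eq {ρ ρ' : Matrix Q Q ℂ} (hρ : ρ.PosSemidef)
    (hρ' : ρ'.PosSemidef) {E : Matrix Q L ℂ} (hE : E * Eᴴ = 1) {U : Matrix Q L ℂ}
    (hU : U * Uᴴ = ρ) :
    ∃ V : Matrix Q L ℂ, V * Vᴴ = ρ' ∧
      hsSq (U - V) = ρ.trace.re + ρ'.trace.re - 2 * fidelity ρ ρ' := by
  obtain ⟨W, hW, hWU⟩ := exists_unitary_of_mul_conjTranspose_eq (X := CFC.sqrt ρ * E) (Y := U)
    (by rw [mul_conjTranspose_mul_of_eq_one _ hE, sqrt_mul_conjTranspose hρ, hU])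
  set F := E * W
  have hF : F * Fᴴ = 1 := by rw [mul_conjTranspose_mul_of_eq_one _ hW, hE]
  have hUF : U = CFC.sqrt ρ * F := by rw [← hWU, Matrix.mul_assoc]
  set M := CFC.sqrt ρ * CFC.sqrt ρ'
  have hM : (Mᴴ * M).PosSemidef := posSemidef_conjTranspose_mul_self M
  obtain ⟨W₁, hW₁, hMW⟩ := exists_unitary_of_mul_conjTranspose_eq (X := Mᴴ)
    (Y := CFC.sqrt (Mᴴ * M)) (by rw [sqrt_mul_conjTranspose hM, conjTranspose_conjTranspose])
  have hW₁' : W₁ᴴ * W₁ᴴᴴ = 1 := by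
    rw [conjTranspose_conjTranspose]; exact mul_eq_one_comm.1 hW₁
  have hV : (CFC.sqrt ρ' * W₁ᴴ * F) * (CFC.sqrt ρ' * W₁ᴴ * F)ᴴ = ρ' := by
    rw [mul_conjTranspose_mul_of_eq_one _ hF, mul_conjTranspose_mul_of_eq_one _ hW₁',
      sqrt_mul_conjTranspose hρ']
  refine ⟨CFC.sqrt ρ' * W₁ᴴ * F, hV, ?_⟩
  rw [hs_sub_sq, hsSq_eq_re_trace, hU, hsSq_eq_re_trace, hV]
  congr 3
  have h1 : U * (CFC.sqrt ρ' * W₁ᴴ * F)ᴴ = CFC.sqrt ρ * W₁ * CFC.sqrt ρ' := by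
    simp only [conjTranspose_mul, conjTranspose_conjTranspose, conjTranspose_sqrt]
    rw [hUF, Matrix.mul_assoc, ← Matrix.mul_assoc F, hF, Matrix.one_mul, Matrix.mul_assoc]
  have h2 : Mᴴ = CFC.sqrt ρ' * CFC.sqrt ρ := by
    simp only [M, conjTranspose_mul, conjTranspose_sqrt]
  rw [h1, Matrix.trace_mul_comm, ← Matrix.mul_assoc, ← h2, hMW]

end Uhlmann

/-! ### A quantitative continuity bound for the square root -/

section SqrtDifference

variable {n : Type*} [Fintype n] [DecidableEq n]

/-- The equation `(a + b) G + G (a + b) = 2 (a - b)` is solvable for positive `a` and `b`, even if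
`a + b` is singular, since `a - b` vanishes on the kernel of `a + b`. -/
lemma exists_lyapunov {a b : Matrix n n ℂ} (ha : a.PosSemidef) (hb : b.PosSemidef) :
    ∃ G : Matrix n n ℂ, Gᴴ = G ∧ (a + b) * G + G * (a + b) = (2 : ℝ) • (a - b) := by
  have hs : (a + b).PosSemidef := ha.add hb
  obtain ⟨U, lam, hlam0, hUU, hUU', hdiag⟩ : ∃ (U : Matrix n n ℂ) (lam : n → ℝ),
      (∀ i, 0 ≤ lam i) ∧ Uᴴ * U = 1 ∧ U * Uᴴ = 1 ∧
        a + b = U * diagonal (fun i => (lam i : ℂ)) * Uᴴ :=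
    ⟨hs.1.eigenvectorUnitary, hs.1.eigenvalues, hs.eigenvalues_nonneg,
      Unitary.coe_star_mul_self hs.1.eigenvectorUnitary,
      Unitary.coe_mul_star_self hs.1.eigenvectorUnitary, hs.1.spectral_theorem⟩
  have hconj : Uᴴ * (a + b) * U = diagonal (fun i => (lam i : ℂ)) := by
    rw [hdiag, ← Matrix.mul_assoc, ← Matrix.mul_assoc, hUU, Matrix.one_mul, Matrix.mul_assoc, hUU,
      Matrix.mul_one]
  have ha' : (Uᴴ * a * U).PosSemidef := ha.conjTranspose_mul_mul_same U
  have hb' : (Uᴴ * b * U).PosSemidef := hb.conjTranspose_mul_mul_same U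
  have hker : ∀ c : Matrix n n ℂ, c.PosSemidef → ∀ i, (c i i).re = 0 → ∀ j, c i j = 0 := by
    intro c hc i hi j
    have h := mul_eq_zero_of_re_trace_eq_zero hc
      (C := (Matrix.of fun (_ : Unit) k => if k = i then (1 : ℂ) else 0)) (by
        simp [Matrix.trace, Matrix.mul_apply, hi])
    have := congrFun (congrFun h ()) j
    simpa [Matrix.mul_apply] using this
  set D := Uᴴ * (a - b) * U with hD
  have hDs : Dᴴ = D := by
    simp [hD, conjTranspose_mul, ha.1.eq, hb.1.eq, Matrix.mul_assoc]
  have hzero : ∀ i j, lam i + lam j = 0 → D i j = 0 := by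
    intro i j hij
    have hi : lam i = 0 := by linarith [hlam0 i, hlam0 j]
    have hsum : (Uᴴ * a * U) i i + (Uᴴ * b * U) i i = 0 := by
      rw [← Matrix.add_apply, ← Matrix.add_mul, ← Matrix.mul_add, hconj]; simp [hi]
    have h1 := (Complex.le_def.1 (ha'.diag_nonneg (i := i))).1
    have h2 := (Complex.le_def.1 (hb'.diag_nonneg (i := i))).1
    have h3 := congrArg Complex.re hsum
    simp only [Complex.add_re, Complex.zero_re] at h1 h2 h3
    have e1 := hker _ ha' i (by linarith) j
    have e2 := hker _ hb' i (by linarith) j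
    rw [hD, Matrix.mul_sub, Matrix.sub_mul, Matrix.sub_apply, e1, e2, sub_zero]
  set G' : Matrix n n ℂ := Matrix.of fun i j => 2 * D i j / ((lam i + lam j : ℝ) : ℂ) with hG'
  have hG's : G'ᴴ = G' := by
    ext i j
    have : star (D j i) = D i j := by
      rw [← conjTranspose_apply, hDs]
    simp only [hG', conjTranspose_apply, of_apply, star_div₀, star_mul', this]
    simp [add_comm]
  have hly : diagonal (fun i => (lam i : ℂ)) * G' + G' * diagonal (fun i => (lam i : ℂ))
      = (2 : ℝ) • D := by
    ext i j
    simp only [Matrix.add_apply, Matrix.diagonal_mul, Matrix.mul_diagonal, Matrix.smul_apply]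
    by_cases h : lam i + lam j = 0
    · simp [hG', hzero i j h]
    · have h' : ((lam i : ℂ) + lam j) ≠ 0 := by exact_mod_cast h
      simp only [hG', of_apply, Complex.ofReal_add, Complex.real_smul, Complex.ofReal_ofNat]
      field_simp
  refine ⟨U * G' * Uᴴ, ?_, ?_⟩
  · simp [conjTranspose_mul, hG's, Matrix.mul_assoc]
  · have e1 : (a + b) * (U * G' * Uᴴ) = U * (diagonal (fun i => (lam i : ℂ)) * G') * Uᴴ := by
      rw [hdiag]
      simp only [Matrix.mul_assoc]
      rw [← Matrix.mul_assoc Uᴴ U, hUU, Matrix.one_mul]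
    have e2 : (U * G' * Uᴴ) * (a + b) = U * (G' * diagonal (fun i => (lam i : ℂ))) * Uᴴ := by
      rw [hdiag]
      simp only [Matrix.mul_assoc]
      rw [← Matrix.mul_assoc Uᴴ U, hUU, Matrix.one_mul]
    rw [e1, e2, ← Matrix.add_mul, ← Matrix.mul_add, hly, Matrix.mul_smul, Matrix.smul_mul, hD]
    congr 1
    simp only [Matrix.mul_assoc]
    rw [hUU', Matrix.mul_one, ← Matrix.mul_assoc, hUU', Matrix.one_mul]

/-- The square roots `a` of `a²` and `q²` of `q⁴` are close in Hilbert–Schmidt norm if `a²` and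
`q⁴` are close in the `χ²`-divergence `Tr Z²`, where `a² - q⁴ = q Z q`. -/
theorem hsSq_sub_le_of_sub_eq {a q Z : Matrix n n ℂ} (ha : a.PosSemidef) (hq : q.PosSemidef)
    (h : a * a - q * q * (q * q) = q * Z * q) : hsSq (a - q * q) ≤ hsSq Z := by
  obtain ⟨b, hbq⟩ : ∃ b, b = q * q := ⟨_, rfl⟩
  have hb : b.PosSemidef := by
    have := posSemidef_self_mul_conjTranspose q
    rwa [hq.1.eq, ← hbq] at this
  rw [← hbq] at h ⊢
  obtain ⟨G, hG, hly⟩ := exists_lyapunov ha hb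
  obtain ⟨s, hsab⟩ : ∃ s, s = a + b := ⟨_, rfl⟩
  have hsp : s.PosSemidef := hsab ▸ ha.add hb
  have hbs : b ≤ s := by rw [hsab]; exact le_add_of_nonneg_left ha.nonneg
  have hDs : (a - b)ᴴ = a - b := by rw [conjTranspose_sub, ha.1.eq, hb.1.eq]
  rw [← hsab] at hly
  have htwo : ∀ X : Matrix n n ℂ, ((2 : ℝ) • X).trace.re = 2 * X.trace.re := by
    intro X; simp [trace_smul]
  have h1 : hsSq (a - b) = (Z * (q * G * q)).trace.re := by
    have e1 : 2 * hsSq (a - b) = ((a - b) * (s * G + G * s)).trace.re := by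
      rw [hly, hsSq_eq_re_trace, hDs, Matrix.mul_smul, htwo]
    have e2 : ((a - b) * (s * G + G * s)).trace = (((a - b) * s + s * (a - b)) * G).trace := by
      rw [Matrix.mul_add, Matrix.add_mul, trace_add, trace_add, ← Matrix.mul_assoc,
        ← Matrix.mul_assoc (a - b) G s, Matrix.trace_mul_cycle (a - b) G s]
    have e3 : (a - b) * s + s * (a - b) = (2 : ℝ) • (a * a - b * b) := by
      rw [hsab, two_smul]; noncomm_ring
    rw [e2, e3, h, Matrix.smul_mul, htwo] at e1
    have e4 : (q * Z * q * G).trace = (Z * (q * G * q)).trace := by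
      rw [Matrix.mul_assoc, Matrix.mul_assoc, Matrix.trace_mul_comm]
      simp only [Matrix.mul_assoc]
    rw [← e4]
    linarith
  have h2 : hsSq (q * G * q) ≤ hsSq (a - b) := by
    have e1 : hsSq (q * G * q) = (b * (G * b * G)).trace.re := by
      have : (q * G * q)ᴴ = q * G * q := by
        simp only [conjTranspose_mul, hG, hq.1.eq, Matrix.mul_assoc]
      rw [hsSq_eq_re_trace, this, Matrix.mul_assoc q G q, Matrix.mul_assoc q (G * q),
        Matrix.trace_mul_comm, hbq]
      simp only [Matrix.mul_assoc]
      rw [Matrix.trace_mul_comm]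
      simp only [Matrix.mul_assoc]
    have hGX : ∀ X : Matrix n n ℂ, X.PosSemidef → (G * X * G).PosSemidef := fun X hX => by
      simpa [hG] using hX.mul_mul_conjTranspose_same G
    have e2 : (b * (G * b * G)).trace.re ≤ (s * (G * s * G)).trace.re := by
      refine (re_trace_mul_le_of_le hbs (hGX b hb)).trans ?_
      have : (s * (G * b * G)).trace = (b * (G * s * G)).trace := by
        rw [Matrix.trace_mul_comm, Matrix.mul_assoc, Matrix.mul_assoc, Matrix.trace_mul_comm]
        simp only [Matrix.mul_assoc]
      rw [this]
      exact re_trace_mul_le_of_le hbs (hGX s hsp)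
    have e3 : hsSq (s * G + G * s) = 4 * hsSq (a - b) := by
      rw [hly, hsSq_eq_re_trace, hsSq_eq_re_trace, conjTranspose_smul, Matrix.mul_smul,
        Matrix.smul_mul]
      simp [trace_smul]
      ring
    have e4 : hsSq (s * G + G * s) - hsSq (s * G - G * s) = 4 * (s * (G * s * G)).trace.re := by
      rw [hsSq_eq_re_trace, hsSq_eq_re_trace]
      simp only [conjTranspose_add, conjTranspose_sub, conjTranspose_mul, hG, hsp.1.eq]
      have : (s * G + G * s) * (G * s + s * G) - (s * G - G * s) * (G * s - s * G) =
          (2 : ℝ) • (s * (G * s * G)) + (2 : ℝ) • (G * (s * G * s)) := by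
        rw [two_smul, two_smul]; noncomm_ring
      rw [← Complex.sub_re, ← trace_sub, this, trace_add, Complex.add_re, htwo, htwo,
        Matrix.trace_mul_comm G]
      simp only [Matrix.mul_assoc]
      ring
    have := hsSq_nonneg (s * G - G * s)
    rw [e1]
    linarith
  have h3 : hs (a - b) * hs (a - b) ≤ hs Z * hs (a - b) := by
    rw [← sq, hs_sq, h1]
    exact (re_trace_mul_le _ _).trans
      (mul_le_mul_of_nonneg_left (Real.sqrt_le_sqrt h2) (hs_nonneg _))
  rw [← hs_sq, ← hs_sq]
  rcases (hs_nonneg (a - b)).eq_or_lt with h0 | h0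
  · rw [← h0, zero_pow two_ne_zero]
    exact sq_nonneg _
  · exact pow_le_pow_left₀ h0.le (le_of_mul_le_mul_right h3 h0) 2

end SqrtDifference

/-! ### Channels -/

section Channels

variable {m n r : Type*} [Fintype m] [Fintype n] [Fintype r]

/-- Complete positivity with an arbitrary finite ancilla. -/
lemma Channel.ampliate_posSemidef (N : Channel m n) {X : Matrix (m × r) (m × r) ℂ}
    (hX : X.PosSemidef) : (ampliate N.toMap X).PosSemidef := by
  let e := Fintype.equivFin r
  have h := N.completelyPositive (Fintype.card r)
    (X.submatrix (fun i => (i.1, e.symm i.2)) (fun i => (i.1, e.symm i.2))) (hX.submatrix _)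
  have h' := h.submatrix (fun i : n × r => (i.1, e i.2))
  convert h' using 1
  ext p q
  simp [ampliate]

lemma Channel.trace_ampliate (N : Channel m n) (X : Matrix (m × r) (m × r) ℂ) :
    (ampliate N.toMap X).trace = X.trace := by
  simp only [Matrix.trace, Matrix.diag, ampliate, of_apply, Fintype.sum_prod_type_right]
  refine Finset.sum_congr rfl fun k _ => ?_
  exact N.tracePreserving (Matrix.of fun a b => X (a, k) (b, k))

/-- `Φ ⊗ id_r` as a linear map. -/
def ampliateₗ (Φ : Matrix m m ℂ →ₗ[ℂ] Matrix n n ℂ) (r : Type*) :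
    Matrix (m × r) (m × r) ℂ →ₗ[ℂ] Matrix (n × r) (n × r) ℂ where
  toFun := ampliate Φ
  map_add' X Y := by
    ext p q
    have : (Matrix.of fun a b => (X + Y) (a, p.2) (b, q.2)) =
        (Matrix.of fun a b => X (a, p.2) (b, q.2)) + Matrix.of fun a b => Y (a, p.2) (b, q.2) := rfl
    simp only [ampliate, of_apply, Matrix.add_apply]
    rw [← Matrix.add_apply, ← map_add, ← this]
    rfl
  map_smul' c X := by
    ext p q
    have : (Matrix.of fun a b => (c • X) (a, p.2) (b, q.2)) =
        c • Matrix.of fun a b => X (a, p.2) (b, q.2) := rfl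
    simp only [ampliate, of_apply, Matrix.smul_apply, RingHom.id_apply]
    rw [← Matrix.smul_apply, ← map_smul, ← this]
    rfl

@[simp] lemma ampliateₗ_apply (Φ : Matrix m m ℂ →ₗ[ℂ] Matrix n n ℂ)
    (X : Matrix (m × r) (m × r) ℂ) : ampliateₗ Φ r X = ampliate Φ X := rfl

lemma traceSnd_ampliate (N : Channel m n) (X : Matrix (m × r) (m × r) ℂ) :
    traceSnd (ampliate N.toMap X) = N.toMap (traceSnd X) := by
  have : traceSnd X = ∑ k, Matrix.of fun a b => X (a, k) (b, k) := by
    ext a b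
    simp [traceSnd, Matrix.sum_apply]
  ext i j
  rw [this, map_sum, Matrix.sum_apply]
  rfl

variable [DecidableEq m]

/-- The map with Kraus operators `K i`. -/
def krausMap (K : r → Matrix n m ℂ) : Matrix m m ℂ →ₗ[ℂ] Matrix n n ℂ where
  toFun X := ∑ i, K i * X * (K i)ᴴ
  map_add' X Y := by simp [Matrix.mul_add, Matrix.add_mul, Finset.sum_add_distrib]
  map_smul' c X := by simp [Finset.smul_sum]

lemma krausMap_apply_apply (K : r → Matrix n m ℂ) (X : Matrix m m ℂ) (b b' : n) :
    krausMap K X b b' = ∑ i, ∑ a, ∑ a', K i b a * X a a' * star (K i b' a') := by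
  change (∑ i, K i * X * (K i)ᴴ) b b' = _
  rw [Matrix.sum_apply]
  refine Finset.sum_congr rfl fun i _ => ?_
  simp only [Matrix.mul_apply, Finset.sum_mul, conjTranspose_apply]
  exact Finset.sum_comm

lemma ampliate_krausMap {k : Type*} [Fintype k] [DecidableEq k] (K : r → Matrix n m ℂ)
    (X : Matrix (m × k) (m × k) ℂ) :
    ampliate (krausMap K) X =
      ∑ i, (K i ⊗ₖ (1 : Matrix k k ℂ)) * X * (K i ⊗ₖ (1 : Matrix k k ℂ))ᴴ := by
  ext ⟨b, p⟩ ⟨b', p'⟩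
  simp only [ampliate, of_apply]
  rw [krausMap_apply_apply, Matrix.sum_apply]
  refine Finset.sum_congr rfl fun i _ => ?_
  simp only [Matrix.mul_apply, Finset.sum_mul, conjTranspose_apply, kroneckerMap_apply,
    Matrix.one_apply, Fintype.sum_prod_type, mul_ite, mul_one, mul_zero, ite_mul, zero_mul,
    apply_ite star, star_zero, Finset.sum_ite_eq, Finset.mem_univ, if_true]
  rw [Finset.sum_comm]
  rfl

/-- The channel with Kraus operators `K i`, where `∑ Kᵢ† Kᵢ = 1`. -/
def krausChannel (K : r → Matrix n m ℂ) (hK : ∑ i, (K i)ᴴ * K i = 1) : Channel m n where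
  toMap := krausMap K
  completelyPositive k X hX := by
    rw [ampliate_krausMap]
    exact posSemidef_sum _ fun i _ => hX.mul_mul_conjTranspose_same _
  tracePreserving X := by
    change (∑ i, K i * X * (K i)ᴴ).trace = _
    rw [trace_sum]
    simp only [Matrix.trace_mul_cycle (K _) X]
    rw [← trace_sum, ← Finset.sum_mul, hK, Matrix.one_mul]

end Channels

/-! ### Codes from isometric encoders and positive operator valued measures -/

section Encoder

variable {M C A r : Type*} [Fintype M] [Fintype C] [Fintype A] [Fintype r]
  [DecidableEq M] [DecidableEq C]

/-- Kraus operators of the encoder that reads the message `m`, applies the isometry with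
coefficient matrix `E m` from the register `C` to `r ⊗ A`, and discards `r`. -/
def encKraus (E : M → Matrix C (r × A) ℂ) (i : M × r) : Matrix A (M × C) ℂ :=
  Matrix.of fun a p => if p.1 = i.1 then E i.1 p.2 (i.2, a) else 0

lemma sum_encKraus {E : M → Matrix C (r × A) ℂ} (hE : ∀ m, E m * (E m)ᴴ = 1) :
    ∑ i, (encKraus E i)ᴴ * encKraus E i = 1 := by
  ext ⟨m, c⟩ ⟨m', c'⟩
  have h := congrFun (congrFun (hE m) c') c
  simp only [Matrix.mul_apply, conjTranspose_apply, Fintype.sum_prod_type, Matrix.one_apply] at h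
  rw [Matrix.sum_apply, Matrix.one_apply]
  simp only [Matrix.mul_apply, conjTranspose_apply, encKraus, of_apply, Fintype.sum_prod_type,
    apply_ite star, star_zero, ite_mul, mul_ite, zero_mul, mul_zero]
  by_cases hm : m = m'
  · subst hm
    simp only [Prod.mk.injEq, true_and, Finset.sum_ite_irrel, Finset.sum_const_zero,
      Finset.sum_ite_eq, Finset.mem_univ, if_true]
    simp only [eq_comm (a := c)]
    rw [← h]
    simp only [mul_comm]
  · simp only [Prod.mk.injEq, hm, false_and, if_false]
    refine Finset.sum_eq_zero fun x _ => Finset.sum_eq_zero fun y _ =>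
      Finset.sum_eq_zero fun z _ => ?_
    by_cases h1 : m' = x
    · simp [← h1, hm]
    · simp [h1]

end Encoder

section Decoder

variable {M b : Type*} [Fintype M] [Fintype b] [DecidableEq M] [DecidableEq b]

/-- Kraus operators of the channel that measures `Lam` and records the outcome. -/
noncomputable def decKraus (Lam : M → Matrix b b ℂ) (i : M × b) : Matrix M b ℂ :=
  Matrix.of fun m x => if m = i.1 then CFC.sqrt (Lam i.1) i.2 x else 0

lemma sum_decKraus {Lam : M → Matrix b b ℂ} (h0 : ∀ m, (Lam m).PosSemidef)
    (h1 : ∑ m, Lam m = 1) : ∑ i, (decKraus Lam i)ᴴ * decKraus Lam i = 1 := by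
  rw [← h1, Fintype.sum_prod_type]
  refine Finset.sum_congr rfl fun m _ => ?_
  ext x y
  have h := congrFun (congrFun (sqrt_mul_sqrt (h0 m)) x) y
  rw [Matrix.mul_apply] at h
  rw [Matrix.sum_apply, ← h]
  refine Finset.sum_congr rfl fun c _ => ?_
  have h2 : star (CFC.sqrt (Lam m) c x) = CFC.sqrt (Lam m) x c := by
    rw [← conjTranspose_apply, conjTranspose_sqrt]
  simp [Matrix.mul_apply, decKraus, apply_ite star, ← h2]

lemma krausMap_decKraus_diag {Lam : M → Matrix b b ℂ} (h0 : ∀ m, (Lam m).PosSemidef)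
    (X : Matrix b b ℂ) (m : M) : krausMap (decKraus Lam) X m m = (Lam m * X).trace := by
  have h : (Lam m * X).trace =
      (CFC.sqrt (Lam m) * X * (CFC.sqrt (Lam m))ᴴ).trace := by
    rw [Matrix.trace_mul_cycle, conjTranspose_sqrt, sqrt_mul_sqrt (h0 m)]
  rw [h, krausMap_apply_apply, Fintype.sum_prod_type,
    Finset.sum_eq_single m (by intro x _ hx; simp [decKraus, hx.symm]) (by simp)]
  simp only [decKraus, of_apply, if_true, Matrix.trace, Matrix.diag, Matrix.mul_apply,
    Finset.sum_mul, conjTranspose_apply]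
  refine Finset.sum_congr rfl fun c _ => ?_
  rw [Finset.sum_comm]

end Decoder

section CodeConstruction

variable {A S S' B : Type*} [Fintype A] [Fintype S] [Fintype S'] [Fintype B]

/-- The vector in `(S E_B) ⊗ (r A)` with coefficient matrix `Y`, regrouped as a vector in
`((A S) E_B) ⊗ r`. -/
def regroup {S F r A : Type*} (Y : Matrix (S × F) (r × A) ℂ) : Matrix ((A × S) × F) r ℂ :=
  Matrix.of fun p k => Y (p.1.2, p.2) (k, p.1.1)

lemma regroup_sub {S F r A : Type*} (X Y : Matrix (S × F) (r × A) ℂ) :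
    regroup (X - Y) = regroup X - regroup Y := rfl

lemma hsSq_regroup {S F r A : Type*} [Fintype S] [Fintype F] [Fintype r] [Fintype A]
    (Y : Matrix (S × F) (r × A) ℂ) : hsSq (regroup Y) = hsSq Y := by
  simp only [hsSq, regroup, of_apply, Fintype.sum_prod_type]
  rw [Finset.sum_comm]
  refine Finset.sum_congr rfl fun s _ => ?_
  rw [Finset.sum_comm]
  refine Finset.sum_congr rfl fun x _ => ?_
  rw [Finset.sum_comm]

lemma hs_regroup {S F r A : Type*} [Fintype S] [Fintype F] [Fintype r] [Fintype A]
    (Y : Matrix (S × F) (r × A) ℂ) : hs (regroup Y) = hs Y := by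
  rw [hs, hs, hsSq_regroup]

/-- The coefficient matrix of `φ ⊗ θ` for the bipartition of the registers into the part `S E_B`
out of the sender's reach and the sender's part `E_A S'`. -/
def sharedVector {EA EB : Type*} (φ : S × S' → ℂ) (θ : EA × EB → ℂ) :
    Matrix (S × EB) (EA × S') ℂ :=
  Matrix.of fun p c => φ (p.1, c.2) * θ (c.1, p.2)

/-- Isometries `E m` for the sender and a sub-normalized measurement `Lam` for the receiver define
a code, and bound its error probabilities. -/
theorem exists_code_errorProb_le {r : Type*} [Fintype r] {R : ℝ} [Nonempty (Message R)]
    (N : Channel (A × S) B) (φ : S × S' → ℂ) {EA EB : Type} [Fintype EA] [Fintype EB]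
    [DecidableEq EA] [DecidableEq S'] [DecidableEq (B × EB)]
    {θ : EA × EB → ℂ} (hθ : IsKet θ)
    {E : Message R → Matrix (EA × S') (r × A) ℂ} (hE : ∀ m, E m * (E m)ᴴ = 1)
    {Lam : Message R → Matrix (B × EB) (B × EB) ℂ} (h0 : ∀ m, (Lam m).PosSemidef)
    (h1 : ∑ m, Lam m ≤ 1) :
    ∃ C : Code A S' B R, ∀ m, C.errorProb N φ m ≤
      ((1 - Lam m) * ampliate N.toMap (regroup (sharedVector φ θ * E m) *
        (regroup (sharedVector φ θ * E m))ᴴ)).trace.re := by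
  -- The missing outcome of the measurement is decoded as an arbitrary fixed message.
  obtain ⟨m₀⟩ := ‹Nonempty (Message R)›
  set Lam' : Message R → Matrix (B × EB) (B × EB) ℂ :=
    fun m => Lam m + if m = m₀ then 1 - ∑ m, Lam m else 0 with hLam'
  have hrest : (1 - ∑ m, Lam m).PosSemidef := le_iff.1 h1
  have h0' : ∀ m, (Lam' m).PosSemidef := fun m => by
    by_cases h : m = m₀
    · simp only [hLam', h, if_true]; exact (h0 m₀).add hrest
    · simp only [hLam', h, if_false, add_zero]; exact h0 m
  have hle : ∀ m, Lam m ≤ Lam' m := fun m => by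
    rw [le_iff]
    by_cases h : m = m₀
    · simpa [hLam', h] using hrest
    · simpa [hLam', h] using PosSemidef.zero
  have h1' : ∑ m, Lam' m = 1 := by simp [hLam', Finset.sum_add_distrib]
  let C : Code A S' B R :=
    { EA := EA, EB := EB, fintypeEA := inferInstance, fintypeEB := inferInstance
      θ := θ, isKet_θ := hθ
      enc := krausChannel (encKraus E) (sum_encKraus hE)
      dec := krausChannel (decKraus Lam') (sum_decKraus h0' h1') }
  refine ⟨C, fun m => ?_⟩
  have henc : C.encodedState φ m =
      regroup (sharedVector φ θ * E m) * (regroup (sharedVector φ θ * E m))ᴴ := by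
    ext ⟨⟨a, s⟩, x⟩ ⟨⟨a', s'⟩, x'⟩
    change krausMap (encKraus E) (Matrix.of fun p q => C.initialState φ m (p, (s, x)) (q, (s', x')))
      a a' = _
    rw [krausMap_apply_apply, Fintype.sum_prod_type,
      Finset.sum_eq_single m _ (by simp)]
    · simp only [Matrix.mul_apply, conjTranspose_apply, regroup, of_apply]
      refine Finset.sum_congr rfl fun k _ => ?_
      rw [star_sum, Finset.sum_mul_sum]
      simp only [Code.initialState, ketbra, vecMulVec_apply, Pi.star_apply, encKraus, of_apply,
        Fintype.sum_prod_type (α₁ := Message R), ite_mul, zero_mul, apply_ite star, star_zero,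
        mul_ite, mul_zero, Finset.sum_ite_irrel, Finset.sum_const_zero, Finset.sum_ite_eq',
        Finset.mem_univ, if_true, one_mul, sharedVector, star_mul']
      refine Finset.sum_congr rfl fun c _ => Finset.sum_congr rfl fun c' _ => ?_
      simp only [C]
      ring
    · intro m' _ hm'
      refine Finset.sum_eq_zero fun k _ => Finset.sum_eq_zero fun p _ =>
        Finset.sum_eq_zero fun q _ => ?_
      by_cases hp : p.1 = m'
      · have : p.1 ≠ m := fun h => hm' (hp.symm.trans h)
        simp [Code.initialState, ketbra, vecMulVec_apply, this]
      · simp [encKraus, hp]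
  set σ := ampliate N.toMap (C.encodedState φ m) with hσ
  have hσp : σ.PosSemidef := N.ampliate_posSemidef (by
    rw [henc]; exact posSemidef_self_mul_conjTranspose _)
  have hout : ∀ m', C.outputState N φ m m' m' = (Lam' m' * σ).trace := fun m' =>
    krausMap_decKraus_diag h0' σ m'
  have herr : C.errorProb N φ m = ((1 - Lam' m) * σ).trace.re := by
    rw [Code.errorProb, ← h1', ← Finset.add_sum_erase _ _ (Finset.mem_univ m), add_sub_cancel_left,
      Finset.sum_mul, trace_sum, Complex.re_sum]
    refine Finset.sum_congr (by ext; simp) fun m' _ => ?_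
    rw [hout]
  rw [herr, ← henc]
  exact re_trace_mul_le_of_le (sub_le_sub le_rfl (hle m)) hσp

end CodeConstruction

/-! ### Stability of probabilities under perturbation of purifications -/

section Stability

/-- The square root of the probability of an event is a seminorm on purifications, dominated by the
Hilbert–Schmidt norm. -/
theorem sqrt_le_sqrt_add_hs {p r : Type*} [Fintype p] [Fintype r] (f : Matrix p p ℂ →ₗ[ℝ] ℝ)
    (hf0 : ∀ X, X.PosSemidef → 0 ≤ f X) (hf1 : ∀ X, X.PosSemidef → f X ≤ X.trace.re)
    (P Q : Matrix p r ℂ) : √(f (P * Pᴴ)) ≤ √(f (Q * Qᴴ)) + hs (P - Q) := by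
  refine le_of_forall_pos_le_add fun η hη => ?_
  set a := √(f (Q * Qᴴ)) with ha
  have ha0 : 0 ≤ a := Real.sqrt_nonneg _
  have ha2 : a ^ 2 = f (Q * Qᴴ) := Real.sq_sqrt (hf0 _ (posSemidef_self_mul_conjTranspose _))
  set b := hs (P - Q)
  have hb0 : 0 ≤ b := hs_nonneg _
  have hb2 : f ((P - Q) * (P - Q)ᴴ) ≤ b ^ 2 := by
    rw [hs_sq, hsSq_eq_re_trace]; exact hf1 _ (posSemidef_self_mul_conjTranspose _)
  -- The optimal `t = b / a` is perturbed to remain meaningful if `a` or `b` vanishes.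
  obtain ⟨a', b', ha', hb', haa, hbb, hab⟩ : ∃ a' b' : ℝ, 0 < a' ∧ 0 < b' ∧ a ≤ a' ∧ b ≤ b' ∧
      a' + b' = a + b + η := ⟨a + η / 2, b + η / 2, by positivity, by positivity, by linarith,
        by linarith, by ring⟩
  have ht : 0 < b' / a' := by positivity
  have h := le_iff.1 (mul_conjTranspose_le P Q ht)
  have h' := hf0 _ h
  rw [map_sub, map_add, map_smul, map_smul, smul_eq_mul, smul_eq_mul, ← ha2] at h'
  rw [← hab]
  refine Real.sqrt_le_iff.2 ⟨by positivity, ?_⟩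
  have h1 : (1 + b' / a') * a ^ 2 ≤ (1 + b' / a') * a' ^ 2 := by gcongr
  have h2 : (1 + (b' / a')⁻¹) * f ((P - Q) * (P - Q)ᴴ) ≤ (1 + (b' / a')⁻¹) * b' ^ 2 := by
    have : b ^ 2 ≤ b' ^ 2 := by gcongr
    exact mul_le_mul_of_nonneg_left (hb2.trans this) (by positivity)
  have h3 : (1 + b' / a') * a' ^ 2 + (1 + (b' / a')⁻¹) * b' ^ 2 = (a' + b') ^ 2 := by
    field_simp
    ring
  linarith

end Stability

/-! ### Partial traces -/

section PartialTrace

variable {S D : Type*} [Fintype S] [Fintype D]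

lemma trace_traceSnd (X : Matrix (S × D) (S × D) ℂ) : (traceSnd X).trace = X.trace := by
  simp [traceSnd, Matrix.trace, Fintype.sum_prod_type]

lemma trace_traceFst (X : Matrix (S × D) (S × D) ℂ) : (traceFst X).trace = X.trace := by
  simp [traceFst, Matrix.trace, Fintype.sum_prod_type_right]

lemma posSemidef_traceSnd {X : Matrix (S × D) (S × D) ℂ} (hX : X.PosSemidef) :
    (traceSnd X).PosSemidef := by
  have : traceSnd X = ∑ a, X.submatrix (fun s => (s, a)) (fun s => (s, a)) := by
    ext s t; simp [traceSnd, Matrix.sum_apply]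
  rw [this]
  exact posSemidef_sum _ fun a _ => hX.submatrix _

lemma posSemidef_traceFst {X : Matrix (S × D) (S × D) ℂ} (hX : X.PosSemidef) :
    (traceFst X).PosSemidef := by
  have : traceFst X = ∑ a, X.submatrix (fun s => (a, s)) (fun s => (a, s)) := by
    ext s t; simp [traceFst, Matrix.sum_apply]
  rw [this]
  exact posSemidef_sum _ fun a _ => hX.submatrix _

variable [DecidableEq S] [DecidableEq D]

lemma traceSnd_kronecker_one_mul_mul (y y' : Matrix S S ℂ) (X : Matrix (S × D) (S × D) ℂ) :
    traceSnd ((y ⊗ₖ (1 : Matrix D D ℂ)) * X * (y' ⊗ₖ (1 : Matrix D D ℂ))) =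
      y * traceSnd X * y' := by
  ext s t
  simp only [traceSnd, of_apply, Matrix.mul_apply, kroneckerMap_apply, Matrix.one_apply,
    Fintype.sum_prod_type, mul_ite, mul_one, mul_zero, ite_mul, zero_mul, Finset.sum_ite_eq,
    Finset.sum_ite_eq', Finset.mem_univ, if_true, Finset.sum_mul, Finset.mul_sum]
  rw [Finset.sum_comm]
  refine Finset.sum_congr rfl fun i _ => ?_
  rw [Finset.sum_comm]

lemma traceSnd_one_kronecker_mul_comm (c : Matrix D D ℂ) (X : Matrix (S × D) (S × D) ℂ) :
    traceSnd (((1 : Matrix S S ℂ) ⊗ₖ c) * X) = traceSnd (X * ((1 : Matrix S S ℂ) ⊗ₖ c)) := by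
  ext s t
  simp only [traceSnd, of_apply, Matrix.mul_apply, kroneckerMap_apply, Matrix.one_apply,
    Fintype.sum_prod_type, mul_ite, mul_zero, ite_mul, zero_mul, one_mul,
    Finset.sum_ite_irrel, Finset.sum_const_zero, Finset.sum_ite_eq,
    Finset.sum_ite_eq', Finset.mem_univ, if_true]
  rw [Finset.sum_comm]
  simp only [mul_comm]

lemma traceSnd_kronecker (y : Matrix S S ℂ) (c : Matrix D D ℂ) :
    traceSnd (y ⊗ₖ c) = c.trace • y := by
  ext s t
  simp [traceSnd, Matrix.trace, ← Finset.mul_sum, mul_comm]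

lemma trace_kronecker_one_mul (y : Matrix S S ℂ) (X : Matrix (S × D) (S × D) ℂ) :
    ((y ⊗ₖ (1 : Matrix D D ℂ)) * X).trace = (y * traceSnd X).trace := by
  have := traceSnd_kronecker_one_mul_mul y 1 X
  rw [one_kronecker_one, Matrix.mul_one, Matrix.mul_one] at this
  rw [← trace_traceSnd, this]

end PartialTrace

/-! ### Operators on many copies of a register -/

section Sites

variable {ι S D : Type*} [Fintype ι] [DecidableEq ι] [Fintype S] [Fintype D]

lemma sum_prod_sites {R : Type*} [CommSemiring R] (f : ι → D → R) :
    ∑ x : ι → D, ∏ i, f i (x i) = ∏ i, ∑ a, f i a := by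
  classical
  rw [Finset.prod_univ_sum, Fintype.piFinset_univ]

lemma prod_ite_site {R : Type*} [CommSemiring R] (j : ι) (a b : ι → R) :
    ∏ i, (if i = j then a i else b i) = a j * ∏ i ∈ Finset.univ.erase j, b i := by
  rw [← Finset.mul_prod_erase _ _ (Finset.mem_univ j), if_pos rfl]
  congr 1
  exact Finset.prod_congr rfl fun i hi => if_neg (Finset.ne_of_mem_erase hi)

/-- The operator on `S ⊗ D^ι` that acts as `X` on `S` and the copy `j` of `D`, and as `c` on each
of the other copies of `D`. -/
def localOp (X : Matrix (S × D) (S × D) ℂ) (c : Matrix D D ℂ) (j : ι) :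
    Matrix (S × (ι → D)) (S × (ι → D)) ℂ :=
  Matrix.of fun p q => X (p.1, p.2 j) (q.1, q.2 j) *
    ∏ i ∈ Finset.univ.erase j, c (p.2 i) (q.2 i)

/-- The operator `y ⊗ c^{⊗ι}` on `S ⊗ D^ι`. -/
def prodOp (ι : Type*) [Fintype ι] (y : Matrix S S ℂ) (c : Matrix D D ℂ) :
    Matrix (S × (ι → D)) (S × (ι → D)) ℂ :=
  Matrix.of fun p q => y p.1 q.1 * ∏ i, c (p.2 i) (q.2 i)

lemma localOp_apply_eq_prod (X : Matrix (S × D) (S × D) ℂ) (c : Matrix D D ℂ) (j : ι)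
    (p q : S × (ι → D)) : localOp X c j p q =
      ∏ i, if i = j then X (p.1, p.2 i) (q.1, q.2 i) else c (p.2 i) (q.2 i) := by
  rw [prod_ite_site]; rfl

lemma localOp_kronecker (y : Matrix S S ℂ) (c : Matrix D D ℂ) (j : ι) :
    localOp (y ⊗ₖ c) c j = prodOp ι y c := by
  ext p q
  simp only [localOp, prodOp, of_apply, kroneckerMap_apply]
  rw [mul_assoc, Finset.mul_prod_erase _ (fun i => c (p.2 i) (q.2 i)) (Finset.mem_univ j)]

lemma localOp_sub (X Y : Matrix (S × D) (S × D) ℂ) (c : Matrix D D ℂ) (j : ι) :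
    localOp (X - Y) c j = localOp X c j - localOp Y c j := by
  ext p q; simp [localOp, sub_mul]

lemma conjTranspose_localOp (X : Matrix (S × D) (S × D) ℂ) (c : Matrix D D ℂ) (j : ι) :
    (localOp X c j)ᴴ = localOp Xᴴ cᴴ j := by
  ext p q; simp [localOp, conjTranspose_apply]

lemma localOp_mul (X Y : Matrix (S × D) (S × D) ℂ) (c c' : Matrix D D ℂ) (j : ι) :
    localOp X c j * localOp Y c' j = localOp (X * Y) (c * c') j := by
  ext p q
  have h : ∀ s : S, ∑ z : ι → D, localOp X c j p (s, z) * localOp Y c' j (s, z) q =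
      (∑ a, X (p.1, p.2 j) (s, a) * Y (s, a) (q.1, q.2 j)) *
        ∏ i ∈ Finset.univ.erase j, (c * c') (p.2 i) (q.2 i) := by
    intro s
    simp only [localOp_apply_eq_prod, ← Finset.prod_mul_distrib]
    rw [sum_prod_sites (fun i a => (if i = j then X (p.1, p.2 i) (s, a) else c (p.2 i) a) *
      (if i = j then Y (s, a) (q.1, q.2 i) else c' a (q.2 i)))]
    rw [← prod_ite_site j (fun i => ∑ a, X (p.1, p.2 i) (s, a) * Y (s, a) (q.1, q.2 i))
      (fun i => (c * c') (p.2 i) (q.2 i))]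
    refine Finset.prod_congr rfl fun i _ => ?_
    by_cases hi : i = j <;> simp [hi, Matrix.mul_apply]
  rw [Matrix.mul_apply, Fintype.sum_prod_type, Finset.sum_congr rfl fun s _ => h s,
    ← Finset.sum_mul, ← Fintype.sum_prod_type' fun s a => X (p.1, p.2 j) (s, a) *
      Y (s, a) (q.1, q.2 j)]
  rfl

lemma localOp_one_one [DecidableEq S] [DecidableEq D] (j : ι) :
    localOp (1 : Matrix (S × D) (S × D) ℂ) (1 : Matrix D D ℂ) j = 1 := by
  rw [← one_kronecker_one, localOp_kronecker]
  ext ⟨s, x⟩ ⟨t, y⟩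
  simp only [prodOp, of_apply, Matrix.one_apply, Prod.mk.injEq]
  rw [Finset.prod_ite_zero]
  simp [funext_iff, ← ite_and, and_comm]

lemma trace_localOp (X : Matrix (S × D) (S × D) ℂ) {c : Matrix D D ℂ} (hc : c.trace = 1) (j : ι) :
    (localOp X c j).trace = X.trace := by
  simp only [Matrix.trace, Matrix.diag, Fintype.sum_prod_type, localOp_apply_eq_prod]
  refine Finset.sum_congr rfl fun s _ => ?_
  rw [sum_prod_sites (fun i a => if i = j then X (s, a) (s, a) else c a a)]
  rw [← Finset.mul_prod_erase _ _ (Finset.mem_univ j), Finset.prod_eq_one]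
  · simp
  · intro i hi
    rw [Matrix.trace] at hc
    simpa [Finset.ne_of_mem_erase hi] using hc

/-- Operators at two different sites are correlated only through the common register `S`. -/
lemma trace_localOp_mul_of_ne (X Y : Matrix (S × D) (S × D) ℂ) {c c' : Matrix D D ℂ}
    (hc : (c * c').trace = 1) {j k : ι} (hjk : j ≠ k) :
    (localOp X c j * localOp Y c' k).trace =
      ∑ s, ∑ t, (∑ a, ∑ b, X (s, a) (t, b) * c' b a) * ∑ a, ∑ b, c a b * Y (t, b) (s, a) := by
  simp only [Matrix.trace, Matrix.diag, Matrix.mul_apply, Fintype.sum_prod_type,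
    localOp_apply_eq_prod, ← Finset.prod_mul_distrib]
  refine Finset.sum_congr rfl fun s _ => ?_
  rw [Finset.sum_comm]
  refine Finset.sum_congr rfl fun t _ => ?_
  have h1 : ∀ x : ι → D, ∑ y : ι → D, ∏ i,
      ((if i = j then X (s, x i) (t, y i) else c (x i) (y i)) *
        (if i = k then Y (t, y i) (s, x i) else c' (y i) (x i))) =
      ∏ i, ∑ b, ((if i = j then X (s, x i) (t, b) else c (x i) b) *
        (if i = k then Y (t, b) (s, x i) else c' b (x i))) := fun x =>
    sum_prod_sites (fun i b => (if i = j then X (s, x i) (t, b) else c (x i) b) *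
        (if i = k then Y (t, b) (s, x i) else c' b (x i)))
  rw [Finset.sum_congr rfl fun x _ => h1 x,
    sum_prod_sites (fun i a => ∑ b, ((if i = j then X (s, a) (t, b) else c a b) *
        (if i = k then Y (t, b) (s, a) else c' b a)))]
  rw [← Finset.mul_prod_erase _ _ (Finset.mem_univ j),
    ← Finset.mul_prod_erase _ _ (Finset.mem_erase.2 ⟨hjk.symm, Finset.mem_univ k⟩),
    Finset.prod_eq_one]
  · simp [hjk, hjk.symm]
  · intro i hi
    have hik := Finset.ne_of_mem_erase hi
    have hij := Finset.ne_of_mem_erase (Finset.mem_of_mem_erase hi)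
    simpa [hik, hij, Matrix.trace, Matrix.mul_apply] using hc

lemma posSemidef_localOp [DecidableEq S] [DecidableEq D] {X : Matrix (S × D) (S × D) ℂ}
    {c : Matrix D D ℂ} (hX : X.PosSemidef) (hc : c.PosSemidef) (j : ι) :
    (localOp X c j).PosSemidef := by
  have : localOp X c j = localOp (CFC.sqrt X) (CFC.sqrt c) j *
      (localOp (CFC.sqrt X) (CFC.sqrt c) j)ᴴ := by
    rw [conjTranspose_localOp, conjTranspose_sqrt, conjTranspose_sqrt, localOp_mul,
      sqrt_mul_sqrt hX, sqrt_mul_sqrt hc]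
  rw [this]
  exact posSemidef_self_mul_conjTranspose _

lemma ampliate_localOp {S' : Type*} [Fintype S'] (Φ : Matrix S S ℂ →ₗ[ℂ] Matrix S' S' ℂ)
    (X : Matrix (S × D) (S × D) ℂ) (c : Matrix D D ℂ) (j : ι) :
    ampliate Φ (localOp X c j) = localOp (ampliate Φ X) c j := by
  ext p q
  have : (Matrix.of fun a b => localOp X c j (a, p.2) (b, q.2)) =
      (∏ i ∈ Finset.univ.erase j, c (p.2 i) (q.2 i)) •
        Matrix.of fun a b => X (a, p.2 j) (b, q.2 j) := by
    ext a b
    simp [localOp, mul_comm]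
  simp only [ampliate, of_apply]
  rw [this, map_smul]
  simp [localOp, mul_comm]

lemma prodOp_mul (y y' : Matrix S S ℂ) (c c' : Matrix D D ℂ) :
    prodOp ι y c * prodOp ι y' c' = prodOp ι (y * y') (c * c') := by
  ext p q
  simp only [Matrix.mul_apply, Fintype.sum_prod_type, prodOp, of_apply, Finset.sum_mul]
  refine Finset.sum_congr rfl fun s _ => ?_
  rw [← sum_prod_sites (fun i a => c (p.2 i) a * c' a (q.2 i)), Finset.mul_sum]
  refine Finset.sum_congr rfl fun x _ => ?_
  rw [Finset.prod_mul_distrib]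
  ring

lemma conjTranspose_prodOp (y : Matrix S S ℂ) (c : Matrix D D ℂ) :
    (prodOp ι y c)ᴴ = prodOp ι yᴴ cᴴ := by
  ext p q; simp [prodOp, conjTranspose_apply]

lemma posSemidef_prodOp [DecidableEq S] [DecidableEq D] {y : Matrix S S ℂ} {c : Matrix D D ℂ}
    (hy : y.PosSemidef) (hc : c.PosSemidef) : (prodOp ι y c).PosSemidef := by
  have : prodOp ι y c = prodOp ι (CFC.sqrt y) (CFC.sqrt c) *
      (prodOp ι (CFC.sqrt y) (CFC.sqrt c))ᴴ := by
    rw [conjTranspose_prodOp, conjTranspose_sqrt, conjTranspose_sqrt, prodOp_mul,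
      sqrt_mul_sqrt hy, sqrt_mul_sqrt hc]
  rw [this]
  exact posSemidef_self_mul_conjTranspose _

lemma sqrt_prodOp [DecidableEq S] [DecidableEq D] [DecidableEq (S × (ι → D))]
    {y : Matrix S S ℂ} {c : Matrix D D ℂ} (hy : y.PosSemidef) (hc : c.PosSemidef) :
    CFC.sqrt (prodOp ι y c) = prodOp ι (CFC.sqrt y) (CFC.sqrt c) :=
  CFC.sqrt_unique (by rw [prodOp_mul, sqrt_mul_sqrt hy, sqrt_mul_sqrt hc])
    (posSemidef_prodOp (posSemidef_sqrt y) (posSemidef_sqrt c)).nonneg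

lemma trace_prodOp (y : Matrix S S ℂ) {c : Matrix D D ℂ} (hc : c.trace = 1) :
    (prodOp ι y c).trace = y.trace := by
  simp only [Matrix.trace, Matrix.diag, Fintype.sum_prod_type, prodOp, of_apply]
  refine Finset.sum_congr rfl fun s _ => ?_
  rw [← Finset.mul_sum, sum_prod_sites (fun _ a => c a a)]
  rw [Matrix.trace] at hc
  simp only [Matrix.diag] at hc
  simp [hc]

/-! ### Purifications on many copies of a register -/

variable [DecidableEq D]

/-- The canonical purification `√σ^{⊗ι}` of `σ^{⊗ι}`. -/
noncomputable def copiesVector (ι : Type*) [Fintype ι] (σ : Matrix D D ℂ) :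
    (ι → D) × (ι → D) → ℂ :=
  fun p => ∏ i, CFC.sqrt σ (p.2 i) (p.1 i)

lemma sum_copiesVector {σ : Matrix D D ℂ} (hσ : σ.PosSemidef) (x x' : ι → D) :
    ∑ e, copiesVector ι σ (e, x) * star (copiesVector ι σ (e, x')) = ∏ i, σ (x i) (x' i) := by
  simp only [copiesVector, star_prod, ← Finset.prod_mul_distrib]
  rw [sum_prod_sites (fun i a => CFC.sqrt σ (x i) a * star (CFC.sqrt σ (x' i) a))]
  refine Finset.prod_congr rfl fun i _ => ?_
  conv_rhs => rw [← sqrt_mul_conjTranspose hσ]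
  rfl

lemma isKet_copiesVector {σ : Matrix D D ℂ} (hσ : σ.PosSemidef) (hσ1 : σ.trace = 1) :
    IsKet (copiesVector ι σ) := by
  have h : ∑ x : ι → D, ∑ e, copiesVector ι σ (e, x) * star (copiesVector ι σ (e, x)) = 1 := by
    simp only [sum_copiesVector hσ]
    rw [sum_prod_sites (fun _ a => σ a a)]
    rw [Matrix.trace] at hσ1
    simp only [Matrix.diag] at hσ1
    simp [hσ1]
  rw [IsKet, Fintype.sum_prod_type_right]
  simp only [RCLike.star_def, Complex.mul_conj, Complex.normSq_eq_norm_sq] at h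
  exact_mod_cast h

lemma sharedVector_mul_conjTranspose {S' : Type*} [Fintype S'] (φ : S × S' → ℂ)
    {σ : Matrix D D ℂ} (hσ : σ.PosSemidef) :
    sharedVector φ (copiesVector ι σ) * (sharedVector φ (copiesVector ι σ))ᴴ =
      prodOp ι (traceSnd (ketbra φ)) σ := by
  ext p q
  simp only [Matrix.mul_apply, conjTranspose_apply, sharedVector, of_apply, prodOp, traceSnd,
    ketbra, vecMulVec_apply, Pi.star_apply, ← sum_copiesVector hσ, Fintype.sum_prod_type_right,
    Finset.sum_mul, Finset.mul_sum, star_mul']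
  rw [Finset.sum_comm]
  refine Finset.sum_congr rfl fun e _ => ?_
  refine Finset.sum_congr rfl fun s' _ => ?_
  ring

variable {G : Type*} [Fintype G]

/-- For a purification `u` of a state of `S ⊗ D`, the purification `u ⊗ √σ^{⊗ι}` of the product of
its marginal on `S` with `σ^{⊗ι}`. -/
noncomputable def productPurification (ι : Type*) [Fintype ι] (σ : Matrix D D ℂ)
    (u : Matrix (S × D) G ℂ) : Matrix (S × (ι → D)) ((D × G) × (ι → D)) ℂ :=
  Matrix.of fun p c => u (p.1, c.1.1) c.1.2 * copiesVector ι σ (c.2, p.2)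

lemma productPurification_mul_conjTranspose {σ : Matrix D D ℂ} (hσ : σ.PosSemidef)
    (u : Matrix (S × D) G ℂ) :
    productPurification ι σ u * (productPurification ι σ u)ᴴ =
      prodOp ι (traceSnd (u * uᴴ)) σ := by
  ext p q
  simp only [Matrix.mul_apply, conjTranspose_apply, productPurification, of_apply, prodOp,
    traceSnd, ← sum_copiesVector hσ, Fintype.sum_prod_type, Finset.sum_mul, Finset.mul_sum,
    star_mul']
  symm
  rw [Finset.sum_comm]
  refine Finset.sum_congr rfl fun a _ => ?_
  rw [Finset.sum_comm]
  refine Finset.sum_congr rfl fun g _ => ?_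
  refine Finset.sum_congr rfl fun e _ => ?_
  ring

lemma hsSq_productPurification_sub {σ : Matrix D D ℂ} (hσ : σ.PosSemidef) (hσ1 : σ.trace = 1)
    (u v : Matrix (S × D) G ℂ) :
    hsSq (productPurification ι σ u - productPurification ι σ v) = hsSq (u - v) := by
  have : productPurification ι σ u - productPurification ι σ v =
      productPurification ι σ (u - v) := by
    ext p c; simp [productPurification, sub_mul]
  rw [this, hsSq_eq_re_trace, productPurification_mul_conjTranspose hσ, trace_prodOp _ hσ1,
    trace_traceSnd, hsSq_eq_re_trace]

end Sites

section Mixture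

variable {ι S D Rf A J : Type*} [Fintype ι] [DecidableEq ι] [Fintype S] [Fintype D] [DecidableEq D]
  [Fintype Rf] [Fintype A] [Fintype J]

/-- For a purification `u` of a state of `S ⊗ D` with purifying register `Rf ⊗ A`, the purification
of the uniform mixture over `j : J` of the states in which that state occupies `S` and the copy
`g j` of `D`, and the other copies are in the state `σ`. The purifying register holds `j`, a
purification of the other copies (its part at the site `g j` is in the fixed state `d₀`), and
`Rf ⊗ A`. The summand `H` of the label space is not used by the vector, and makes the purifying
register as large as needed. -/
noncomputable def mixturePurification (H : Type*) (σ : Matrix D D ℂ) (g : J → ι) (d₀ : D)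
    (u : Matrix (S × D) (Rf × A) ℂ) :
    Matrix (S × (ι → D)) (((J × (ι → D) × Rf) ⊕ H) × A) ℂ :=
  Matrix.of fun p c => Sum.elim
    (fun k => ((√(Fintype.card J))⁻¹ : ℝ) * (u (p.1, p.2 (g k.1)) (k.2.2, c.2) *
      ∏ i, if i = g k.1 then (if k.2.1 i = d₀ then 1 else 0)
        else CFC.sqrt σ (p.2 i) (k.2.1 i))) (fun _ => 0) c.1

variable {H : Type*} [Fintype H]

/-- Summation over the labels of the copies in a product of two mixture purifications. -/
lemma sum_mixturePurification {σ : Matrix D D ℂ} (hσ : σ.PosSemidef) (g : J → ι) (d₀ : D)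
    (u v : Matrix (S × D) (Rf × A) ℂ) (p q : S × (ι → D)) (j : J) (f : Rf) (a a' : A) :
    ∑ y, mixturePurification H σ g d₀ u p (Sum.inl (j, y, f), a) *
        star (mixturePurification H σ g d₀ v q (Sum.inl (j, y, f), a')) =
      ((Fintype.card J : ℝ)⁻¹ : ℝ) * (u (p.1, p.2 (g j)) (f, a) *
        star (v (q.1, q.2 (g j)) (f, a')) *
        ∏ i ∈ Finset.univ.erase (g j), σ (p.2 i) (q.2 i)) := by
  have h : ∑ y : ι → D, (∏ i, if i = g j then (if y i = d₀ then (1 : ℂ) else 0)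
        else CFC.sqrt σ (p.2 i) (y i)) *
        star (∏ i, if i = g j then (if y i = d₀ then (1 : ℂ) else 0)
        else CFC.sqrt σ (q.2 i) (y i)) = ∏ i ∈ Finset.univ.erase (g j), σ (p.2 i) (q.2 i) := by
    simp only [star_prod, ← Finset.prod_mul_distrib]
    rw [sum_prod_sites (fun i b => (if i = g j then (if b = d₀ then (1 : ℂ) else 0)
        else CFC.sqrt σ (p.2 i) b) * star (if i = g j then (if b = d₀ then (1 : ℂ) else 0)
        else CFC.sqrt σ (q.2 i) b))]
    rw [← Finset.mul_prod_erase _ _ (Finset.mem_univ (g j))]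
    simp only [if_true, apply_ite star, star_one, star_zero, mul_ite, mul_one, mul_zero,
      ite_mul, one_mul, zero_mul, Finset.sum_ite_eq', Finset.mem_univ]
    refine Finset.prod_congr rfl fun i hi => ?_
    simp only [Finset.ne_of_mem_erase hi, if_false]
    conv_rhs => rw [← sqrt_mul_conjTranspose hσ]
    rfl
  have hn : ((√(Fintype.card J))⁻¹ : ℝ) * ((√(Fintype.card J))⁻¹ : ℝ) =
      ((Fintype.card J : ℝ)⁻¹ : ℝ) := by
    rw [← mul_inv, Real.mul_self_sqrt (Nat.cast_nonneg _)]
  rw [← h, ← hn, Finset.mul_sum, Finset.mul_sum]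
  refine Finset.sum_congr rfl fun y _ => ?_
  simp only [mixturePurification, of_apply, Sum.elim_inl, star_mul', RCLike.star_def,
    Complex.conj_ofReal]
  push_cast
  ring

lemma mixturePurification_mul_conjTranspose {σ : Matrix D D ℂ} (hσ : σ.PosSemidef) (g : J → ι)
    (d₀ : D) (u : Matrix (S × D) (Rf × A) ℂ) :
    mixturePurification H σ g d₀ u * (mixturePurification H σ g d₀ u)ᴴ =
      ((Fintype.card J : ℝ)⁻¹ : ℝ) • ∑ j, localOp (u * uᴴ) σ (g j) := by
  ext p q
  rw [Matrix.smul_apply, Matrix.sum_apply, Complex.real_smul, Finset.mul_sum]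
  simp only [Matrix.mul_apply, conjTranspose_apply, Fintype.sum_prod_type, Fintype.sum_sum_type]
  have h0 : ∀ (h : H) (a : A), mixturePurification H σ g d₀ u p (Sum.inr h, a) = 0 :=
    fun _ _ => rfl
  simp only [h0, zero_mul, Finset.sum_const_zero, add_zero]
  refine Finset.sum_congr rfl fun j _ => ?_
  simp only [localOp, of_apply, Matrix.mul_apply, conjTranspose_apply, Fintype.sum_prod_type,
    Finset.sum_mul, Finset.mul_sum]
  rw [Finset.sum_comm]
  refine Finset.sum_congr rfl fun f _ => ?_
  rw [Finset.sum_comm]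
  exact Finset.sum_congr rfl fun a _ => sum_mixturePurification hσ g d₀ u u p q j f a a

lemma regroup_mixturePurification_mul_conjTranspose {σ : Matrix D D ℂ} (hσ : σ.PosSemidef)
    (g : J → ι) (d₀ : D) (u : Matrix (S × D) (Rf × A) ℂ) :
    regroup (mixturePurification H σ g d₀ u) * (regroup (mixturePurification H σ g d₀ u))ᴴ =
      ((Fintype.card J : ℝ)⁻¹ : ℝ) • ∑ j, localOp (regroup u * (regroup u)ᴴ) σ (g j) := by
  ext p q
  rw [Matrix.smul_apply, Matrix.sum_apply, Complex.real_smul, Finset.mul_sum]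
  simp only [Matrix.mul_apply, conjTranspose_apply, Fintype.sum_prod_type, Fintype.sum_sum_type,
    regroup, of_apply]
  have h0 : ∀ (h : H) (a : A) (q : S × (ι → D)),
      mixturePurification H σ g d₀ u q (Sum.inr h, a) = 0 := fun _ _ _ => rfl
  simp only [h0, zero_mul, Finset.sum_const_zero, add_zero]
  refine Finset.sum_congr rfl fun j _ => ?_
  simp only [localOp, of_apply, Matrix.mul_apply, conjTranspose_apply,
    Finset.sum_mul, Finset.mul_sum]
  rw [Finset.sum_comm]
  exact Finset.sum_congr rfl fun f _ =>
    sum_mixturePurification hσ g d₀ u u (p.1.2, p.2) (q.1.2, q.2) j f p.1.1 q.1.1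

lemma hsSq_mixturePurification_sub [Nonempty J] {σ : Matrix D D ℂ} (hσ : σ.PosSemidef)
    (hσ1 : σ.trace = 1) (g : J → ι) (d₀ : D) (u v : Matrix (S × D) (Rf × A) ℂ) :
    hsSq (mixturePurification H σ g d₀ u - mixturePurification H σ g d₀ v) = hsSq (u - v) := by
  have : mixturePurification H σ g d₀ u - mixturePurification H σ g d₀ v =
      mixturePurification H σ g d₀ (u - v) := by
    ext p ⟨c | c, a⟩ <;> simp [mixturePurification]
    ring
  rw [this, hsSq_eq_re_trace, mixturePurification_mul_conjTranspose hσ, trace_smul, trace_sum]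
  simp only [trace_localOp _ hσ1, Finset.sum_const, Finset.card_univ,
    trace_mul_conjTranspose_eq_hsSq]
  simp

end Mixture

/-! ### Convex split -/

section ConvexSplit

variable {S D : Type*} [Fintype S] [Fintype D] [DecidableEq S] [DecidableEq D]

lemma kronecker_sub_right (y : Matrix S S ℂ) (c c' : Matrix D D ℂ) :
    y ⊗ₖ (c - c') = y ⊗ₖ c - y ⊗ₖ c' := by
  ext p q; simp [mul_sub]

lemma sub_kronecker_left (y y' : Matrix S S ℂ) (c : Matrix D D ℂ) :
    (y - y') ⊗ₖ c = y ⊗ₖ c - y' ⊗ₖ c := by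
  ext p q; simp [sub_mul]

/-- The support of a bipartite positive operator is contained in the support of its marginal. -/
lemma support_marginal_kronecker_one_mul {ρ : Matrix (S × D) (S × D) ℂ} (hρ : ρ.PosSemidef)
    {e : Matrix S S ℂ} (he : eᴴ = e) (hee : e * e = e) (heρ : e * traceSnd ρ = traceSnd ρ) :
    (e ⊗ₖ (1 : Matrix D D ℂ)) * ρ = ρ := by
  obtain ⟨C, hCdef⟩ : ∃ C, C = (1 - e) ⊗ₖ (1 : Matrix D D ℂ) := ⟨_, rfl⟩
  have hC : C * ρ = 0 := by
    refine mul_eq_zero_of_re_trace_eq_zero hρ (le_of_eq ?_)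
    have hCC : Cᴴ * C = C := by
      rw [hCdef, conjTranspose_kronecker, ← mul_kronecker_mul, conjTranspose_sub, conjTranspose_one,
        he, conjTranspose_one, Matrix.one_mul]
      congr 1
      simp [Matrix.sub_mul, Matrix.mul_sub, hee]
    rw [Matrix.trace_mul_cycle, hCC, hCdef, trace_kronecker_one_mul, Matrix.sub_mul, heρ]
    simp
  rw [hCdef, sub_kronecker_left, one_kronecker_one, Matrix.sub_mul, Matrix.one_mul,
    sub_eq_zero] at hC
  exact hC.symm

/-- The support of an operator below `K ψ ⊗ σ` is contained in the support of `σ`. -/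
lemma one_kronecker_support_mul {ρ : Matrix (S × D) (S × D) ℂ} (hρ : ρ.PosSemidef)
    {ψ : Matrix S S ℂ} {σ : Matrix D D ℂ} {K : ℝ} (h : ρ ≤ K • (ψ ⊗ₖ σ))
    {e : Matrix D D ℂ} (heσ : e * σ = σ) :
    ((1 : Matrix S S ℂ) ⊗ₖ e) * ρ = ρ := by
  obtain ⟨C, hCdef⟩ : ∃ C, C = (1 : Matrix S S ℂ) ⊗ₖ (1 - e) := ⟨_, rfl⟩
  have hCσ : C * (ψ ⊗ₖ σ) = 0 := by
    rw [hCdef, ← mul_kronecker_mul, Matrix.sub_mul, heσ]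
    simp
  have hC : C * ρ = 0 := by
    refine mul_eq_zero_of_re_trace_eq_zero hρ ?_
    have := re_trace_le_of_le (conj_le_conj h C)
    rwa [Matrix.mul_smul, hCσ, smul_zero, Matrix.zero_mul, trace_zero, Complex.zero_re] at this
  rw [hCdef, kronecker_sub_right, one_kronecker_one, Matrix.sub_mul, Matrix.one_mul,
    sub_eq_zero] at hC
  exact hC.symm

/-- For `ρ ≤ K ψ ⊗ σ`, the deviation of `ρ` from the product `ρ_S ⊗ σ` has the form
`(ρ_S^{1/4} ⊗ σ^{1/4}) z (ρ_S^{1/4} ⊗ σ^{1/4})` with `Tr z² ≤ K Tr ψ`, and `z` is invisible to the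
marginal on `S`. -/
lemma exists_normalized_deviation {ρ : Matrix (S × D) (S × D) ℂ} (hρ : ρ.PosSemidef)
    {ψ : Matrix S S ℂ} (hψ : ψ.PosSemidef) {σ : Matrix D D ℂ} (hσ : σ.PosSemidef)
    (hσ1 : σ.trace = 1) {K : ℝ} (hK : 0 ≤ K) (h : ρ ≤ K • (ψ ⊗ₖ σ)) :
    ∃ z : Matrix (S × D) (S × D) ℂ, zᴴ = z ∧
      (CFC.sqrt (CFC.sqrt (traceSnd ρ)) ⊗ₖ CFC.sqrt (CFC.sqrt σ)) * z *
        (CFC.sqrt (CFC.sqrt (traceSnd ρ)) ⊗ₖ CFC.sqrt (CFC.sqrt σ)) = ρ - traceSnd ρ ⊗ₖ σ ∧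
      traceSnd (z * ((1 : Matrix S S ℂ) ⊗ₖ CFC.sqrt σ)) = 0 ∧
      hsSq z ≤ K * ψ.trace.re := by
  set ρS := traceSnd ρ with hρS
  have hρSp : ρS.PosSemidef := posSemidef_traceSnd hρ
  set b := CFC.sqrt ρS
  set s := CFC.sqrt σ
  have hbp : b.PosSemidef := posSemidef_sqrt ρS
  have hsp : s.PosSemidef := posSemidef_sqrt σ
  have hbb : b * b = ρS := sqrt_mul_sqrt hρSp
  have hss : s * s = σ := sqrt_mul_sqrt hσ
  set β := CFC.sqrt b
  set α := CFC.sqrt s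
  have hβp : β.PosSemidef := posSemidef_sqrt b
  have hαp : α.PosSemidef := posSemidef_sqrt s
  have hββ : β * β = b := sqrt_mul_sqrt hbp
  have hαα : α * α = s := sqrt_mul_sqrt hsp
  set βi := pinv β
  set αi := pinv α
  have hβis : βiᴴ = βi := conjTranspose_pinv β
  have hαis : αiᴴ = αi := conjTranspose_pinv α
  obtain ⟨eβ, heβ⟩ : ∃ e, e = β * βi := ⟨_, rfl⟩
  obtain ⟨eα, heα⟩ : ∃ e, e = α * αi := ⟨_, rfl⟩
  have hβc : βi * β = eβ := by rw [heβ]; exact pinv_mul_comm hβp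
  have hαc : αi * α = eα := by rw [heα]; exact pinv_mul_comm hαp
  have heβs : eβᴴ = eβ := by rw [heβ]; exact conjTranspose_mul_pinv hβp
  have heβ2 : eβ * eβ = eβ := by rw [heβ]; exact mul_pinv_idem hβp
  have heα2 : eα * eα = eα := by rw [heα]; exact mul_pinv_idem hαp
  have heαs : eαᴴ = eα := by rw [heα]; exact conjTranspose_mul_pinv hαp
  have heββ : eβ * β = β := by rw [heβ]; exact mul_pinv_mul hβp
  have heαα : eα * α = α := by rw [heα]; exact mul_pinv_mul hαp
  have hβeβ : β * eβ = β := by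
    have := congrArg conjTranspose heββ
    rwa [conjTranspose_mul, heβs, hβp.1.eq] at this
  have hαeα : α * eα = α := by
    have := congrArg conjTranspose heαα
    rwa [conjTranspose_mul, heαs, hαp.1.eq] at this
  have heβρ : eβ * ρS = ρS := by
    rw [← hbb, ← hββ]; simp only [← Matrix.mul_assoc, heββ]
  have heασ : eα * σ = σ := by
    rw [← hss, ← hαα]; simp only [← Matrix.mul_assoc, heαα]
  -- One inverse on each side undoes `β ⊗ α` up to the projections onto supports.
  have hβibβi : βi * b * βi = eβ := by
    rw [← hββ, ← Matrix.mul_assoc, hβc, Matrix.mul_assoc, ← heβ, heβ2]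
  have hαisαi : αi * s * αi = eα := by
    rw [← hαα, ← Matrix.mul_assoc, hαc, Matrix.mul_assoc, ← heα, heα2]
  have hβiρβi : βi * ρS * βi = b := by
    have : βi * ρS * βi = (βi * β) * (β * β) * (β * βi) := by
      rw [← hbb, ← hββ]; simp only [Matrix.mul_assoc]
    rw [this, hβc, ← heβ, ← Matrix.mul_assoc, heββ, Matrix.mul_assoc, hβeβ, hββ]
  have hαiσαi : αi * σ * αi = s := by
    have : αi * σ * αi = (αi * α) * (α * α) * (α * αi) := by
      rw [← hss, ← hαα]; simp only [Matrix.mul_assoc]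
    rw [this, hαc, ← heα, ← Matrix.mul_assoc, heαα, Matrix.mul_assoc, hαeα, hαα]
  have hL1 : (eβ ⊗ₖ (1 : Matrix D D ℂ)) * ρ = ρ :=
    support_marginal_kronecker_one_mul hρ heβs heβ2 heβρ
  have hL2 : ((1 : Matrix S S ℂ) ⊗ₖ eα) * ρ = ρ := one_kronecker_support_mul hρ h heασ
  have hL : (eβ ⊗ₖ eα) * ρ = ρ := by
    have : eβ ⊗ₖ eα = (eβ ⊗ₖ (1 : Matrix D D ℂ)) * ((1 : Matrix S S ℂ) ⊗ₖ eα) := by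
      rw [← mul_kronecker_mul, Matrix.mul_one, Matrix.one_mul]
    rw [this, Matrix.mul_assoc, hL2, hL1]
  have hRadj : ∀ {y : Matrix S S ℂ} {c : Matrix D D ℂ}, yᴴ = y → cᴴ = c → (y ⊗ₖ c) * ρ = ρ →
      ρ * (y ⊗ₖ c) = ρ := by
    intro y c hy hc hyc
    have := congrArg conjTranspose hyc
    rwa [conjTranspose_mul, conjTranspose_kronecker, hy, hc, hρ.1.eq] at this
  have hR : ρ * (eβ ⊗ₖ eα) = ρ := hRadj heβs heαs hL
  have hR2 : ρ * ((1 : Matrix S S ℂ) ⊗ₖ eα) = ρ := hRadj conjTranspose_one heαs hL2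
  set q := β ⊗ₖ α
  set qi := βi ⊗ₖ αi
  have hqis : qiᴴ = qi := by rw [conjTranspose_kronecker, hβis, hαis]
  have hqqi : q * qi = eβ ⊗ₖ eα := by rw [← mul_kronecker_mul, heβ, heα]
  have hqiq : qi * q = eβ ⊗ₖ eα := by rw [← mul_kronecker_mul, hβc, hαc]
  set x := qi * ρ * qi with hx
  have hxp : x.PosSemidef := by simpa [hqis] using hρ.conjTranspose_mul_mul_same qi
  have hx0 : qi * (ρS ⊗ₖ σ) * qi = b ⊗ₖ s := by
    rw [← mul_kronecker_mul, ← mul_kronecker_mul, hβiρβi, hαiσαi]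
  have hbs : (b ⊗ₖ s)ᴴ = b ⊗ₖ s := by
    rw [conjTranspose_kronecker, hbp.1.eq, hsp.1.eq]
  have hzs : (x - b ⊗ₖ s)ᴴ = x - b ⊗ₖ s := by rw [conjTranspose_sub, hxp.1.eq, hbs]
  have hmarg : traceSnd ((x - b ⊗ₖ s) * ((1 : Matrix S S ℂ) ⊗ₖ s)) = 0 := by
    have e1 : x - b ⊗ₖ s = qi * (ρ - ρS ⊗ₖ σ) * qi := by
      rw [← hx0, hx, Matrix.mul_sub, Matrix.sub_mul]
    have e2 : qi = (βi ⊗ₖ (1 : Matrix D D ℂ)) * ((1 : Matrix S S ℂ) ⊗ₖ αi) := by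
      rw [← mul_kronecker_mul, Matrix.mul_one, Matrix.one_mul]
    have e3 : qi * ((1 : Matrix S S ℂ) ⊗ₖ s) =
        ((1 : Matrix S S ℂ) ⊗ₖ (αi * s)) * (βi ⊗ₖ (1 : Matrix D D ℂ)) := by
      rw [← mul_kronecker_mul, ← mul_kronecker_mul, Matrix.mul_one, Matrix.one_mul, Matrix.mul_one]
    have e4 : (x - b ⊗ₖ s) * ((1 : Matrix S S ℂ) ⊗ₖ s) = (βi ⊗ₖ (1 : Matrix D D ℂ)) *
        (((1 : Matrix S S ℂ) ⊗ₖ αi) * ((ρ - ρS ⊗ₖ σ) * ((1 : Matrix S S ℂ) ⊗ₖ (αi * s)))) *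
          (βi ⊗ₖ (1 : Matrix D D ℂ)) := by
      rw [e1, Matrix.mul_assoc, e3]
      rw [e2]
      simp only [Matrix.mul_assoc]
    have e5 : (ρS ⊗ₖ σ) * ((1 : Matrix S S ℂ) ⊗ₖ eα) = ρS ⊗ₖ σ := by
      have := congrArg conjTranspose heασ
      rw [conjTranspose_mul, heαs, hσ.1.eq] at this
      rw [← mul_kronecker_mul, Matrix.mul_one, this]
    have e6 : (ρ - ρS ⊗ₖ σ) * ((1 : Matrix S S ℂ) ⊗ₖ (αi * s)) * ((1 : Matrix S S ℂ) ⊗ₖ αi) =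
        ρ - ρS ⊗ₖ σ := by
      rw [Matrix.mul_assoc, ← mul_kronecker_mul, Matrix.one_mul, hαisαi, Matrix.sub_mul, hR2, e5]
    rw [e4, traceSnd_kronecker_one_mul_mul, traceSnd_one_kronecker_mul_comm, e6]
    have e7 : traceSnd (ρ - ρS ⊗ₖ σ) = traceSnd ρ - traceSnd (ρS ⊗ₖ σ) := by
      ext; simp [traceSnd]
    rw [e7, traceSnd_kronecker, hσ1, one_smul, sub_self]
    simp
  refine ⟨x - b ⊗ₖ s, hzs, ?_, hmarg, ?_⟩
  · have e1 : q * (x - b ⊗ₖ s) * q = (q * qi) * (ρ - ρS ⊗ₖ σ) * (qi * q) := by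
      rw [← hx0, hx]
      noncomm_ring
    have e2 : (eβ ⊗ₖ eα) * (ρS ⊗ₖ σ) = ρS ⊗ₖ σ := by
      rw [← mul_kronecker_mul, heβρ, heασ]
    have e3 : (ρS ⊗ₖ σ) * (eβ ⊗ₖ eα) = ρS ⊗ₖ σ := by
      have := congrArg conjTranspose e2
      rwa [conjTranspose_mul, conjTranspose_kronecker, conjTranspose_kronecker, heβs, heαs,
        hρSp.1.eq, hσ.1.eq] at this
    rw [e1, hqqi, hqiq, Matrix.mul_sub, Matrix.sub_mul, hL, hR, e2, e3]
  · have hcross : (x * (b ⊗ₖ s)).trace = ((b ⊗ₖ s) * (b ⊗ₖ s)).trace := by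
      rw [← sub_eq_zero, ← trace_sub, ← Matrix.sub_mul]
      have : b ⊗ₖ s = ((1 : Matrix S S ℂ) ⊗ₖ s) * (b ⊗ₖ (1 : Matrix D D ℂ)) := by
        rw [← mul_kronecker_mul, Matrix.mul_one, Matrix.one_mul]
      conv_lhs => enter [1, 2]; rw [this]
      rw [← Matrix.mul_assoc, Matrix.trace_mul_comm, trace_kronecker_one_mul, hmarg,
        Matrix.mul_zero, trace_zero]
    have h1 : hsSq (x - b ⊗ₖ s) ≤ hsSq x := by
      rw [hs_sub_sq, hbs, hcross]
      have : hsSq (b ⊗ₖ s) = ((b ⊗ₖ s) * (b ⊗ₖ s)).trace.re := by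
        rw [hsSq_eq_re_trace, hbs]
      have := hsSq_nonneg (b ⊗ₖ s)
      linarith
    have h2 : hsSq x = (ρ * (qi * x * qi)).trace.re := by
      rw [hsSq_eq_re_trace, hxp.1.eq]
      conv_lhs => enter [1, 1, 1]; rw [hx]
      rw [Matrix.mul_assoc qi ρ qi, Matrix.mul_assoc, Matrix.trace_mul_comm]
      simp only [Matrix.mul_assoc]
    have hqx : (qi * x * qi).PosSemidef := by simpa [hqis] using hxp.conjTranspose_mul_mul_same qi
    have h3 : ((ψ ⊗ₖ σ) * (qi * x * qi)).trace = (ψ * eβ).trace := by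
      have e1 : ((ψ ⊗ₖ σ) * (qi * x * qi)).trace =
          ((qi * qi * (ψ ⊗ₖ σ) * (qi * qi)) * ρ).trace := by
        rw [hx]
        have : (ψ ⊗ₖ σ) * (qi * (qi * ρ * qi) * qi) = ((ψ ⊗ₖ σ) * (qi * qi) * ρ) * (qi * qi) := by
          simp only [Matrix.mul_assoc]
        rw [this, Matrix.trace_mul_comm]
        simp only [Matrix.mul_assoc]
      have e2 : qi * qi * (ψ ⊗ₖ σ) * (qi * qi) =
          ((βi * βi * ψ * (βi * βi)) ⊗ₖ (1 : Matrix D D ℂ)) * ((1 : Matrix S S ℂ) ⊗ₖ eα) := by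
        have : αi * αi * σ * (αi * αi) = eα := by
          rw [← hαisαi, ← hαiσαi]; simp only [Matrix.mul_assoc]
        rw [← mul_kronecker_mul, ← mul_kronecker_mul, ← mul_kronecker_mul, ← mul_kronecker_mul,
          this, Matrix.one_mul, Matrix.mul_one]
      have e3 : (βi * βi * ψ * (βi * βi) * ρS).trace = (ψ * (βi * (βi * ρS * βi) * βi)).trace := by
        have : βi * βi * ψ * (βi * βi) * ρS = (βi * βi) * (ψ * (βi * βi) * ρS) := by
          simp only [Matrix.mul_assoc]
        rw [this, Matrix.trace_mul_comm]
        simp only [Matrix.mul_assoc]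
      rw [e1, e2, Matrix.mul_assoc, hL2, trace_kronecker_one_mul, ← hρS, e3, hβiρβi, hβibβi]
    have h4 : (ψ * eβ).trace.re ≤ ψ.trace.re := by
      rw [Matrix.trace_mul_comm]
      have := re_trace_mul_le_of_le (A := eβ) (B := 1) (by rw [heβ]; exact mul_pinv_le_one hβp) hψ
      rwa [Matrix.one_mul] at this
    have h5 := re_trace_mul_le_of_le h hqx
    rw [Matrix.smul_mul, trace_smul, Complex.smul_re, smul_eq_mul, h3] at h5
    calc hsSq (x - b ⊗ₖ s) ≤ hsSq x := h1
      _ ≤ K * (ψ * eβ).trace.re := h2 ▸ h5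
      _ ≤ K * ψ.trace.re := mul_le_mul_of_nonneg_left h4 hK

/-- The convex-split lemma in Hilbert–Schmidt form: placing `ρ ≤ K ψ ⊗ σ` at a uniformly random one
of `|J|` copies of `σ` produces nearly the product state `ρ_S ⊗ σ^{⊗ι}` if `|J|` is large compared
with `K`, because the deviations at different copies are orthogonal. -/
theorem hsSq_sqrt_convexSplit_sub_le {ι J : Type*} [Fintype ι] [DecidableEq ι] [Fintype J]
    [Nonempty J] {g : J → ι} (hg : Function.Injective g)
    {ρ : Matrix (S × D) (S × D) ℂ} (hρ : ρ.PosSemidef)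
    {ψ : Matrix S S ℂ} (hψ : ψ.PosSemidef) {σ : Matrix D D ℂ} (hσ : σ.PosSemidef)
    (hσ1 : σ.trace = 1) {K : ℝ} (hK : 0 ≤ K) (h : ρ ≤ K • (ψ ⊗ₖ σ)) :
    hsSq (CFC.sqrt (((Fintype.card J : ℝ)⁻¹ : ℝ) • ∑ j, localOp ρ σ (g j)) -
      CFC.sqrt (prodOp ι (traceSnd ρ) σ)) ≤ K * ψ.trace.re / Fintype.card J := by
  classical
  obtain ⟨z, hzs, hqz, hmarg, hz⟩ := exists_normalized_deviation hρ hψ hσ hσ1 hK h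
  set n : ℝ := (Fintype.card J : ℝ) with hn
  have hn0 : 0 < n := Nat.cast_pos.2 Fintype.card_pos
  have hρSp : (traceSnd ρ).PosSemidef := posSemidef_traceSnd hρ
  set β := CFC.sqrt (CFC.sqrt (traceSnd ρ)) with hβ
  set s := CFC.sqrt σ with hs
  set α := CFC.sqrt s with hα
  have hαα : α * α = s := sqrt_mul_sqrt (posSemidef_sqrt σ)
  have hββ : β * β = CFC.sqrt (traceSnd ρ) := sqrt_mul_sqrt (posSemidef_sqrt _)
  have hss : s * s = σ := sqrt_mul_sqrt hσ
  have hsstr : (s * s).trace = 1 := by rw [hss, hσ1]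
  set τ := (n⁻¹ : ℝ) • ∑ j, localOp ρ σ (g j)
  have hτ : τ.PosSemidef :=
    (posSemidef_sum _ fun j _ => posSemidef_localOp hρ hσ (g j)).smul (inv_nonneg.2 hn0.le)
  set Z : Matrix (S × (ι → D)) (S × (ι → D)) ℂ := (n⁻¹ : ℝ) • ∑ j, localOp z s (g j) with hZ
  have hω : CFC.sqrt (prodOp ι (traceSnd ρ) σ) = prodOp ι β α * prodOp ι β α := by
    rw [sqrt_prodOp hρSp hσ, prodOp_mul, hαα, hββ]
  have hωω : prodOp ι β α * prodOp ι β α * (prodOp ι β α * prodOp ι β α) =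
      prodOp ι (traceSnd ρ) σ := by
    rw [← hω, sqrt_mul_sqrt (posSemidef_prodOp hρSp hσ)]
  have hαsα : α * s * α = σ := by
    rw [← hss, ← hαα]; simp only [Matrix.mul_assoc]
  have hkey : CFC.sqrt τ * CFC.sqrt τ -
      prodOp ι β α * prodOp ι β α * (prodOp ι β α * prodOp ι β α) =
      prodOp ι β α * Z * prodOp ι β α := by
    have e1 : ∀ j, prodOp ι β α * localOp z s (g j) * prodOp ι β α =
        localOp ρ σ (g j) - prodOp ι (traceSnd ρ) σ := fun j => by
      conv_lhs => rw [← localOp_kronecker β α (g j)]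
      rw [localOp_mul, localOp_mul, hqz, hαsα, localOp_sub, localOp_kronecker]
    rw [sqrt_mul_sqrt hτ, hωω, hZ, Matrix.mul_smul, Matrix.smul_mul, Finset.mul_sum, Finset.sum_mul]
    simp only [e1]
    rw [Finset.sum_sub_distrib, smul_sub, Finset.sum_const, Finset.card_univ,
      ← Nat.cast_smul_eq_nsmul ℝ, ← hn, smul_smul, inv_mul_cancel₀ hn0.ne', one_smul]
  rw [hω]
  refine (hsSq_sub_le_of_sub_eq (posSemidef_sqrt τ)
    (posSemidef_prodOp (posSemidef_sqrt _) (posSemidef_sqrt _)) hkey).trans ?_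
  have horth : ∀ j k, j ≠ k → (localOp z s (g j) * localOp z s (g k)).trace = 0 := by
    intro j k hjk
    rw [trace_localOp_mul_of_ne z z hsstr (hg.ne hjk)]
    refine Finset.sum_eq_zero fun a _ => Finset.sum_eq_zero fun b _ => ?_
    have h1 := congrFun (congrFun hmarg a) b
    simp only [traceSnd, of_apply, Matrix.mul_apply, kroneckerMap_apply, Matrix.one_apply,
      Fintype.sum_prod_type, mul_ite, mul_zero, ite_mul, zero_mul, one_mul, Matrix.zero_apply,
      Finset.sum_ite_irrel, Finset.sum_const_zero, Finset.sum_ite_eq', Finset.mem_univ,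
      if_true] at h1
    rw [h1, zero_mul]
  have hZZ : hsSq Z = n⁻¹ * hsSq z := by
    have hZs : Zᴴ = Z := by
      rw [hZ, conjTranspose_smul, conjTranspose_sum]
      simp only [conjTranspose_localOp, hzs, hs, conjTranspose_sqrt, star_trivial]
    have e1 : (Z * Z).trace = ((n⁻¹ * n⁻¹ : ℝ) : ℂ) * ∑ j : J, ∑ k : J,
        (localOp z s (g j) * localOp z s (g k)).trace := by
      rw [hZ, Matrix.smul_mul, Matrix.mul_smul, smul_smul, Finset.sum_mul_sum, trace_smul,
        trace_sum, Complex.real_smul]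
      simp only [trace_sum]
    have e2 : ∀ j : J, ∑ k : J, (localOp z s (g j) * localOp z s (g k)).trace = (z * z).trace := by
      intro j
      rw [Finset.sum_eq_single j (fun k _ hk => horth j k hk.symm) (by simp), localOp_mul, hss,
        trace_localOp _ hσ1]
    have e3 : (z * z).trace = (hsSq z : ℂ) := by
      rw [← trace_mul_conjTranspose_eq_hsSq, hzs]
    have e4 : (hsSq Z : ℂ) = ((n⁻¹ * hsSq z : ℝ) : ℂ) := by
      rw [← trace_mul_conjTranspose_eq_hsSq, hZs, e1, Finset.sum_congr rfl fun j _ => e2 j, e3,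
        Finset.sum_const, Finset.card_univ, nsmul_eq_mul]
      have : ((Fintype.card J : ℕ) : ℂ) = (n : ℂ) := by rw [hn]; simp
      rw [this, ← Complex.ofReal_mul, ← Complex.ofReal_mul]
      congr 1
      field_simp
    exact_mod_cast e4
  rw [hZZ, inv_mul_eq_div]
  exact div_le_div_of_nonneg_right hz hn0.le

end ConvexSplit

/-! ### Restoring a marginal of a smoothed state -/

section Smoothing

variable {S D G : Type*} [Fintype S] [Fintype D] [Fintype G] [DecidableEq S] [DecidableEq D]

lemma smul_le_smul_of_le {n : Type*} [Fintype n] {X Y : Matrix n n ℂ} (h : X ≤ Y) {c : ℝ}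
    (hc : 0 ≤ c) : c • X ≤ c • Y := by
  rw [le_iff, ← smul_sub]
  exact (le_iff.1 h).smul hc

lemma kronecker_le_kronecker_left {ψ : Matrix S S ℂ} (hψ : ψ.PosSemidef) {X Y : Matrix D D ℂ}
    (h : X ≤ Y) : ψ ⊗ₖ X ≤ ψ ⊗ₖ Y := by
  rw [le_iff, ← kronecker_sub_right]
  exact hψ.kronecker (le_iff.1 h)

/-- The vector in `S ⊗ D ⊗ G` with coefficient matrix `u`, seen as a vector in `D ⊗ (S ⊗ G)`. -/
def moveFst {S D G : Type*} (u : Matrix (S × D) G ℂ) : Matrix D (S × G) ℂ :=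
  Matrix.of fun d p => u (p.1, d) p.2

lemma moveFst_mul_conjTranspose (u : Matrix (S × D) G ℂ) :
    moveFst u * (moveFst u)ᴴ = traceFst (u * uᴴ) := by
  ext d d'
  simp [moveFst, traceFst, Matrix.mul_apply, Fintype.sum_prod_type]

lemma hsSq_moveFst (u : Matrix (S × D) G ℂ) : hsSq (moveFst u) = hsSq u := by
  rw [hsSq_eq_re_trace, moveFst_mul_conjTranspose, trace_traceFst, ← hsSq_eq_re_trace]

lemma moveFst_one_kronecker_mul (T : Matrix D D ℂ) (u : Matrix (S × D) G ℂ) :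
    moveFst (((1 : Matrix S S ℂ) ⊗ₖ T) * u) = T * moveFst u := by
  ext d p
  simp [moveFst, Matrix.mul_apply, Fintype.sum_prod_type, Matrix.one_apply]

/-- If `σ ≤ κ`, an operator `T` maps `κ` below `σ` at a Hilbert–Schmidt cost of `Tr (κ - σ)` on
purifications of operators below `κ`. -/
lemma exists_conj_le_of_le {σ κ : Matrix D D ℂ} (hσ : σ.PosSemidef) (h : σ ≤ κ) :
    ∃ T : Matrix D D ℂ, T * κ * Tᴴ ≤ σ ∧
      ((T - 1) * κ * (T - 1)ᴴ).trace.re ≤ κ.trace.re - σ.trace.re := by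
  have hκ : κ.PosSemidef := posSemidef_of_nonneg (hσ.nonneg.trans h)
  obtain ⟨a, ha⟩ : ∃ a, a = CFC.sqrt σ := ⟨_, rfl⟩
  obtain ⟨k, hk⟩ : ∃ k, k = CFC.sqrt κ := ⟨_, rfl⟩
  have hap : a.PosSemidef := ha ▸ posSemidef_sqrt σ
  have hkp : k.PosSemidef := hk ▸ posSemidef_sqrt κ
  have haa : a * a = σ := by rw [ha, sqrt_mul_sqrt hσ]
  have hkk : k * k = κ := by rw [hk, sqrt_mul_sqrt hκ]
  have hak : a ≤ k := by rw [ha, hk]; exact sqrt_le_sqrt_of_le h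
  have hTs : (a * pinv k)ᴴ = pinv k * a := by
    rw [conjTranspose_mul, conjTranspose_pinv, hap.1.eq]
  have hTκ : a * pinv k * κ = a * k := by
    rw [← hkk, Matrix.mul_assoc, ← Matrix.mul_assoc (pinv k), pinv_mul_comm hkp, mul_pinv_mul hkp]
  have hκT : κ * (pinv k * a) = k * a := by
    have := congrArg conjTranspose hTκ
    rwa [conjTranspose_mul, hTs, conjTranspose_mul, hap.1.eq, hkp.1.eq, hκ.1.eq] at this
  have hTT : a * pinv k * κ * (a * pinv k)ᴴ ≤ σ := by
    have h1 := conj_le_conj (mul_pinv_le_one hkp) a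
    rw [hap.1.eq, Matrix.mul_one, haa] at h1
    rwa [hTs, hTκ, Matrix.mul_assoc, ← Matrix.mul_assoc k, ← Matrix.mul_assoc a]
  refine ⟨a * pinv k, hTT, ?_⟩
  have e : (a * pinv k - 1) * κ * (a * pinv k - 1)ᴴ =
      a * pinv k * κ * (a * pinv k)ᴴ - a * k - k * a + κ := by
    rw [conjTranspose_sub, conjTranspose_one, hTs, Matrix.sub_mul, Matrix.one_mul, Matrix.sub_mul,
      Matrix.mul_sub, Matrix.mul_one, Matrix.mul_sub, Matrix.mul_one, hκT, hTκ]
    abel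
  have h1 := re_trace_le_of_le hTT
  have h2 := re_trace_mul_le_of_le hak hap
  rw [haa] at h2
  rw [e, trace_add, trace_sub, trace_sub, Matrix.trace_mul_comm a k, Complex.add_re, Complex.sub_re,
    Complex.sub_re]
  linarith

/-- If `u` purifies a state with marginal `σ` on `D`, and `v` purifies a nearby operator bounded by
`c ψ ⊗ v_D` for its own marginal `v_D`, then some `w` near `u` purifies an operator bounded by
`3 c ψ ⊗ σ`: the marginal `v_D` is exchanged for `σ` at the cost of a constant factor. -/
theorem exists_near_purification_le {u v : Matrix (S × D) G ℂ} {ψ : Matrix S S ℂ}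
    (hψ : ψ.PosSemidef) {c : ℝ} (hc : 0 ≤ c)
    (hv : v * vᴴ ≤ c • (ψ ⊗ₖ traceFst (v * vᴴ))) :
    ∃ w : Matrix (S × D) G ℂ, hs (u - w) ≤ 9 / 4 * hs (u - v) ∧
      w * wᴴ ≤ (c * 3) • (ψ ⊗ₖ traceFst (u * uᴴ)) := by
  set σ := traceFst (u * uᴴ) with hσdef
  have hσ : σ.PosSemidef := posSemidef_traceFst (posSemidef_self_mul_conjTranspose u)
  have hsub : moveFst v - moveFst u = moveFst (v - u) := rfl
  set Δ := moveFst (v - u) * (moveFst (v - u))ᴴ with hΔ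
  have hΔp : Δ.PosSemidef := posSemidef_self_mul_conjTranspose _
  have hΔtr : Δ.trace.re = hs (u - v) ^ 2 := by
    rw [hΔ, ← hsSq_eq_re_trace, hsSq_moveFst, ← hs_sq, hs_sub_comm]
  -- The marginal of `v` is below `κ = 3 σ + (3/2) Δ`.
  have hvκ : traceFst (v * vᴴ) ≤ (3 : ℝ) • σ + (3 / 2 : ℝ) • Δ := by
    have := mul_conjTranspose_le (moveFst v) (moveFst u) (t := 2) two_pos
    rw [moveFst_mul_conjTranspose, moveFst_mul_conjTranspose, hsub] at this
    norm_num at this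
    exact this
  obtain ⟨T, hT1, hT2⟩ := exists_conj_le_of_le (hσ.smul (by norm_num : (0 : ℝ) ≤ 3))
    (le_add_of_nonneg_right (hΔp.smul (by norm_num : (0 : ℝ) ≤ 3 / 2)).nonneg :
      (3 : ℝ) • σ ≤ (3 : ℝ) • σ + (3 / 2 : ℝ) • Δ)
  refine ⟨((1 : Matrix S S ℂ) ⊗ₖ T) * v, ?_, ?_⟩
  · have h1 : hsSq (((1 : Matrix S S ℂ) ⊗ₖ T) * v - v) ≤ (3 / 2) * hs (u - v) ^ 2 := by
      have e : moveFst (((1 : Matrix S S ℂ) ⊗ₖ T) * v - v) = (T - 1) * moveFst v := by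
        rw [Matrix.sub_mul, Matrix.one_mul, ← moveFst_one_kronecker_mul]; rfl
      rw [← hsSq_moveFst, e, hsSq_eq_re_trace, conjTranspose_mul, Matrix.mul_assoc,
        ← Matrix.mul_assoc (moveFst v), moveFst_mul_conjTranspose, ← Matrix.mul_assoc]
      refine (re_trace_le_of_le (conj_le_conj hvκ (T - 1))).trans (hT2.trans (le_of_eq ?_))
      simp only [trace_add, trace_smul, Complex.add_re, Complex.smul_re, smul_eq_mul, hΔtr]
      ring
    have h0 := hs_nonneg (u - v)
    have h2 : hs (v - ((1 : Matrix S S ℂ) ⊗ₖ T) * v) ≤ 5 / 4 * hs (u - v) := by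
      rw [hs_sub_comm]
      refine hs_le_of_hsSq_le (by positivity) (h1.trans ?_)
      nlinarith [sq_nonneg (hs (u - v))]
    have h3 := hs_sub_le u v (((1 : Matrix S S ℂ) ⊗ₖ T) * v)
    linarith
  · have e : ((1 : Matrix S S ℂ) ⊗ₖ T) * v * (((1 : Matrix S S ℂ) ⊗ₖ T) * v)ᴴ =
        ((1 : Matrix S S ℂ) ⊗ₖ T) * (v * vᴴ) * ((1 : Matrix S S ℂ) ⊗ₖ T)ᴴ := by
      rw [conjTranspose_mul]; simp only [Matrix.mul_assoc]
    rw [e]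
    refine (conj_le_conj hv _).trans ?_
    have e2 : (c * 3) • (ψ ⊗ₖ σ) = c • (ψ ⊗ₖ ((3 : ℝ) • σ)) := by rw [kronecker_smul, mul_smul]
    rw [Matrix.mul_smul, Matrix.smul_mul, conjTranspose_kronecker, ← mul_kronecker_mul,
      ← mul_kronecker_mul, conjTranspose_one, Matrix.one_mul, Matrix.mul_one, e2]
    exact smul_le_smul_of_le (kronecker_le_kronecker_left hψ
      ((conj_le_conj hvκ T).trans hT1)) hc

end Smoothing

/-! ### Position-based decoding -/

section PositionDecoding

variable {B D M J : Type*} [Fintype B] [Fintype D] [Fintype M] [Fintype J]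
  [DecidableEq B] [DecidableEq D] [DecidableEq M] [DecidableEq J]

lemma trace_mul_traceSnd_kronecker (T ρ : Matrix (B × D) (B × D) ℂ) (σ : Matrix D D ℂ) :
    (T * (traceSnd ρ ⊗ₖ σ)).trace =
      ∑ s, ∑ t, (∑ a, ∑ b, T (s, a) (t, b) * σ b a) *
        ∑ a, ∑ b, (1 : Matrix D D ℂ) a b * ρ (t, b) (s, a) := by
  simp only [Matrix.trace, Matrix.diag, Matrix.mul_apply, Fintype.sum_prod_type, kroneckerMap_apply,
    traceSnd, of_apply, Matrix.one_apply, ite_mul, one_mul, zero_mul, Finset.sum_ite_eq,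
    Finset.mem_univ, if_true]
  refine Finset.sum_congr rfl fun s _ => ?_
  rw [Finset.sum_comm]
  refine Finset.sum_congr rfl fun t _ => ?_
  rw [Finset.sum_mul]
  refine Finset.sum_congr rfl fun a _ => ?_
  rw [Finset.sum_mul]
  refine Finset.sum_congr rfl fun b _ => ?_
  ring

/-- From a test `T` between `ρ` and `ρ_B ⊗ σ`, the pretty good measurement finds out at which of the
copies `(m, j)` of `D` the state `ρ` is located, and hence the block `m`. -/
theorem exists_positionDecoder {T : Matrix (B × D) (B × D) ℂ} (hT : T.PosSemidef) (hT1 : T ≤ 1) :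
    ∃ Lam : M → Matrix (B × (M × J → D)) (B × (M × J → D)) ℂ,
      (∀ m, (Lam m).PosSemidef) ∧ ∑ m, Lam m ≤ 1 ∧
      ∀ (ρ : Matrix (B × D) (B × D) ℂ) (σ : Matrix D D ℂ), ρ.PosSemidef → σ.PosSemidef →
        σ.trace = 1 → ∀ m j, ((1 - Lam m) * localOp ρ σ (m, j)).trace.re ≤
          2 * (ρ.trace.re - (T * ρ).trace.re) +
            4 * (Fintype.card M * Fintype.card J * (T * (traceSnd ρ ⊗ₖ σ)).trace.re) := by
  set P : M × J → Matrix (B × (M × J → D)) (B × (M × J → D)) ℂ := fun i => localOp T 1 i with hP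
  set S := ∑ i, P i with hS
  set r := CFC.sqrt S with hr
  have hPp : ∀ i, (P i).PosSemidef := fun i => posSemidef_localOp hT PosSemidef.one i
  have hP1 : ∀ i, P i ≤ 1 := fun i => by
    rw [le_iff, ← localOp_one_one i, ← localOp_sub]
    exact posSemidef_localOp (le_iff.1 hT1) PosSemidef.one i
  have hSp : S.PosSemidef := posSemidef_sum _ fun i _ => hPp i
  have hrp : r.PosSemidef := posSemidef_sqrt S
  have hrr : r * r = S := sqrt_mul_sqrt hSp
  have hPS : ∀ i, P i ≤ S := fun i =>
    Finset.single_le_sum (fun k _ => (hPp k).nonneg) (Finset.mem_univ i)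
  have hLp : ∀ i, (pinv r * P i * pinv r).PosSemidef := fun i => by
    simpa [conjTranspose_pinv] using (hPp i).conjTranspose_mul_mul_same (pinv r)
  refine ⟨fun m => ∑ j, pinv r * P (m, j) * pinv r, fun m => posSemidef_sum _ fun j _ => hLp _,
    ?_, ?_⟩
  · rw [← Fintype.sum_prod_type' fun m j => pinv r * P (m, j) * pinv r]
    simp only [Prod.mk.eta]
    rw [← Finset.sum_mul, ← Finset.mul_sum, ← hS, ← hrr, ← Matrix.mul_assoc, pinv_mul_comm hrp,
      mul_pinv_mul hrp]
    exact mul_pinv_le_one hrp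
  · intro ρ σ hρ hσ hσ1 m j
    have hloc : (localOp ρ σ (m, j)).PosSemidef := posSemidef_localOp hρ hσ _
    have h1 : 1 - ∑ j, pinv r * P (m, j) * pinv r ≤
        (2 : ℝ) • (1 - P (m, j)) + (4 : ℝ) • (S - P (m, j)) := by
      refine le_trans (sub_le_sub le_rfl ?_) (one_sub_pinv_sqrt_conj_le (hPp _) (hP1 _) (hPS _))
      exact Finset.single_le_sum (f := fun j => pinv r * P (m, j) * pinv r)
        (fun k _ => (hLp (m, k)).nonneg) (Finset.mem_univ j)
    refine (re_trace_mul_le_of_le h1 hloc).trans ?_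
    have h2 : (P (m, j) * localOp ρ σ (m, j)).trace = (T * ρ).trace := by
      rw [hP, localOp_mul, Matrix.one_mul, trace_localOp _ hσ1]
    set t := (T * (traceSnd ρ ⊗ₖ σ)).trace.re with ht
    have ht0 : 0 ≤ t :=
      re_trace_mul_nonneg hT ((posSemidef_traceSnd hρ).kronecker hσ)
    have h3 : ((S - P (m, j)) * localOp ρ σ (m, j)).trace.re ≤
        Fintype.card M * Fintype.card J * t := by
      rw [hS, ← Finset.add_sum_erase _ _ (Finset.mem_univ (m, j)), add_sub_cancel_left,
        Finset.sum_mul, trace_sum, Complex.re_sum]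
      have e : ∀ i ∈ Finset.univ.erase (m, j), (P i * localOp ρ σ (m, j)).trace.re = t := by
        intro i hi
        rw [hP, trace_localOp_mul_of_ne T ρ (by rw [Matrix.one_mul, hσ1])
          (Finset.ne_of_mem_erase hi), ht, trace_mul_traceSnd_kronecker]
      rw [Finset.sum_congr rfl e, Finset.sum_const, nsmul_eq_mul]
      refine mul_le_mul_of_nonneg_right ?_ ht0
      have : (Finset.univ.erase (m, j)).card ≤ Fintype.card M * Fintype.card J := by
        rw [← Fintype.card_prod, ← Finset.card_univ]
        exact Finset.card_le_card (Finset.erase_subset _ _)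
      exact_mod_cast this
    rw [Matrix.add_mul, Matrix.smul_mul, Matrix.smul_mul, Matrix.sub_mul 1, Matrix.one_mul,
      trace_add, trace_smul, trace_smul, trace_sub, h2, trace_localOp _ hσ1]
    simp only [Complex.add_re, Complex.smul_re, Complex.sub_re, smul_eq_mul]
    linarith

end PositionDecoding

/-! ### Encoding by purified convex split -/

section Encoding

variable {A S S' D Rf J ι H : Type*} [Fintype A] [Fintype S] [Fintype S'] [Fintype D] [Fintype Rf]
  [Fintype J] [Fintype ι] [Fintype H] [DecidableEq A] [DecidableEq S] [DecidableEq S']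
  [DecidableEq D] [DecidableEq Rf] [DecidableEq J] [DecidableEq ι] [DecidableEq H]

lemma injective_inr_pair {X H r A : Type*} {f : X → H} (hf : Function.Injective f) (a₀ : A) :
    Function.Injective fun x => ((Sum.inr (f x), a₀) : (r ⊕ H) × A) := by
  intro x y hxy
  exact hf (Sum.inr_injective (Prod.ext_iff.1 hxy).1)

/-- The sender can steer `φ ⊗ √σ^{⊗ι}` close to the purification of the mixture in which the state
purified by `u` sits at a random site `g j`. The three injections provide room for the registers of
the intermediate purifications. -/
theorem exists_encoder [Nonempty J] (a₀ : A) (d₀ : D)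
    {f₁ : (ι → D) × S' → H} (hf₁ : Function.Injective f₁)
    {f₂ : (D × (Rf × A)) × (ι → D) → H} (hf₂ : Function.Injective f₂)
    {f₃ : S × (ι → D) → H} (hf₃ : Function.Injective f₃)
    {g : J → ι} (hg : Function.Injective g) {φ : S × S' → ℂ} (hφ : IsKet φ)
    {u w : Matrix (S × D) (Rf × A) ℂ} (huφ : traceSnd (u * uᴴ) = traceSnd (ketbra φ))
    {σ : Matrix D D ℂ} (hσ : σ.PosSemidef) (hσ1 : σ.trace = 1) {K : ℝ} (hK : 0 ≤ K)
    (hw : w * wᴴ ≤ K • (traceSnd (ketbra φ) ⊗ₖ σ)) :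
    ∃ E : Matrix ((ι → D) × S') (((J × (ι → D) × Rf) ⊕ H) × A) ℂ, E * Eᴴ = 1 ∧
      hs (sharedVector φ (copiesVector ι σ) * E - mixturePurification H σ g d₀ u) ≤
        2 * hs (u - w) + √(K / Fintype.card J) := by
  have hφp : (ketbra φ).PosSemidef := posSemidef_vecMulVec_self_star φ
  have hφ1 : (traceSnd (ketbra φ)).trace.re = 1 := by
    rw [trace_traceSnd]
    simp only [IsKet] at hφ
    simpa [ketbra, Matrix.trace, vecMulVec_apply, Complex.mul_conj, Complex.normSq_eq_norm_sq,
      ← Complex.ofReal_pow] using hφ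
  have hwp : (w * wᴴ).PosSemidef := posSemidef_self_mul_conjTranspose w
  obtain ⟨E₁, hE₁⟩ : ∃ E : Matrix ((ι → D) × S') (((J × (ι → D) × Rf) ⊕ H) × A) ℂ, E * Eᴴ = 1 :=
    ⟨_, embedMatrix_mul_conjTranspose (injective_inr_pair hf₁ a₀)⟩
  obtain ⟨E₂, hE₂⟩ : ∃ E : Matrix ((D × (Rf × A)) × (ι → D)) (((J × (ι → D) × Rf) ⊕ H) × A) ℂ,
      E * Eᴴ = 1 := ⟨_, embedMatrix_mul_conjTranspose (injective_inr_pair hf₂ a₀)⟩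
  obtain ⟨E₃, hE₃⟩ : ∃ E : Matrix (S × (ι → D)) (((J × (ι → D) × Rf) ⊕ H) × A) ℂ,
      E * Eᴴ = 1 := ⟨_, embedMatrix_mul_conjTranspose (injective_inr_pair hf₃ a₀)⟩
  set τ := ((Fintype.card J : ℝ)⁻¹ : ℝ) • ∑ j, localOp (w * wᴴ) σ (g j) with hτdef
  have hτ : τ.PosSemidef := (posSemidef_sum _ fun j _ => posSemidef_localOp hwp hσ (g j)).smul
    (inv_nonneg.2 (Nat.cast_nonneg _))
  have hω : (prodOp ι (traceSnd (w * wᴴ)) σ).PosSemidef :=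
    posSemidef_prodOp (posSemidef_traceSnd hwp) hσ
  have n₁ : Near 0 (sharedVector φ (copiesVector ι σ) * E₁) (productPurification ι σ u * E₂) :=
    Near.of_eq (by rw [mul_conjTranspose_mul_of_eq_one _ hE₁, mul_conjTranspose_mul_of_eq_one _ hE₂,
      sharedVector_mul_conjTranspose φ hσ, productPurification_mul_conjTranspose hσ, huφ])
  have n₂ : Near (hs (u - w)) (productPurification ι σ u * E₂) (productPurification ι σ w * E₂) :=
    Near.of_hs_le (by rw [← Matrix.sub_mul, hs_mul_of_mul_conjTranspose_eq_one _ hE₂, hs, hs,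
      hsSq_productPurification_sub hσ hσ1])
  have n₃ : Near 0 (productPurification ι σ w * E₂)
      (CFC.sqrt (prodOp ι (traceSnd (w * wᴴ)) σ) * E₃) :=
    Near.of_eq (by rw [mul_conjTranspose_mul_of_eq_one _ hE₂, mul_conjTranspose_mul_of_eq_one _ hE₃,
      productPurification_mul_conjTranspose hσ, sqrt_mul_conjTranspose hω])
  have n₄ : Near (√(K / Fintype.card J)) (CFC.sqrt (prodOp ι (traceSnd (w * wᴴ)) σ) * E₃)
      (CFC.sqrt τ * E₃) :=
    Near.of_hs_le (by
      have h := hsSq_sqrt_convexSplit_sub_le hg hwp (posSemidef_traceSnd hφp) hσ hσ1 hK hw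
      rw [hφ1, mul_one, ← hτdef] at h
      rw [← Matrix.sub_mul, hs_mul_of_mul_conjTranspose_eq_one _ hE₃, hs_sub_comm]
      exact Real.sqrt_le_sqrt h)
  have n₅ : Near 0 (CFC.sqrt τ * E₃) (mixturePurification H σ g d₀ w) :=
    Near.of_eq (by rw [mul_conjTranspose_mul_of_eq_one _ hE₃, sqrt_mul_conjTranspose hτ,
      mixturePurification_mul_conjTranspose hσ])
  have n₆ : Near (hs (u - w)) (mixturePurification H σ g d₀ w) (mixturePurification H σ g d₀ u) :=
    Near.of_hs_le (by rw [hs_sub_comm, hs, hs, hsSq_mixturePurification_sub hσ hσ1])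
  obtain ⟨W, hW, hle⟩ := ((((n₁.trans n₂).trans n₃).trans n₄).trans n₅).trans n₆
  refine ⟨E₁ * W, by rw [mul_conjTranspose_mul_of_eq_one _ hW, hE₁], ?_⟩
  rw [← Matrix.mul_assoc]
  refine hle.trans (le_of_eq ?_)
  ring

end Encoding

/-! ### The achievability bound -/

/-- The probability of the event `G` after the channel `N`, as a linear functional of the input. -/
noncomputable def eventProb {m n F : Type*} [Fintype m] [Fintype n] [Fintype F] (N : Channel m n)
    (G : Matrix (n × F) (n × F) ℂ) : Matrix (m × F) (m × F) ℂ →ₗ[ℝ] ℝ where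
  toFun X := (G * ampliate N.toMap X).trace.re
  map_add' X Y := by
    rw [← ampliateₗ_apply, map_add, Matrix.mul_add, trace_add, Complex.add_re]; rfl
  map_smul' c X := by
    have h : c • X = (c : ℂ) • X := by ext; simp
    rw [h, ← ampliateₗ_apply, map_smul, Matrix.mul_smul, trace_smul]
    simp

lemma eventProb_apply {m n F : Type*} [Fintype m] [Fintype n] [Fintype F] (N : Channel m n)
    (G : Matrix (n × F) (n × F) ℂ) (X : Matrix (m × F) (m × F) ℂ) :
    eventProb N G X = (G * ampliate N.toMap X).trace.re := rfl

lemma eventProb_nonneg {m n F : Type*} [Fintype m] [Fintype n] [Fintype F] (N : Channel m n)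
    {G : Matrix (n × F) (n × F) ℂ} (hG : G.PosSemidef) {X : Matrix (m × F) (m × F) ℂ}
    (hX : X.PosSemidef) : 0 ≤ eventProb N G X :=
  re_trace_mul_nonneg hG (N.ampliate_posSemidef hX)

lemma eventProb_le_trace {m n F : Type*} [Fintype m] [Fintype n] [Fintype F] [DecidableEq n]
    [DecidableEq F] (N : Channel m n) {G : Matrix (n × F) (n × F) ℂ} (hG : G ≤ 1)
    {X : Matrix (m × F) (m × F) ℂ} (hX : X.PosSemidef) : eventProb N G X ≤ X.trace.re := by
  have h := re_trace_mul_le_of_le hG (N.ampliate_posSemidef hX)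
  rwa [Matrix.one_mul, N.trace_ampliate] at h

lemma fidelity_nonneg {n : Type*} [Fintype n] [DecidableEq n] (ρ σ : Matrix n n ℂ) :
    0 ≤ fidelity ρ σ := re_trace_nonneg (posSemidef_sqrt _)

/-- For small `ε`, purifications realizing the fidelity of states in the `ε`-ball have distance
barely more than `ε`. -/
lemma two_sub_two_mul_fidelity_le {n : Type*} [Fintype n] [DecidableEq n] {ρ ρ' : Matrix n n ℂ}
    {ε : ℝ} (hε0 : 0 < ε) (hε : 6 * ε < 1) (h : ρ' ∈ ball ε ρ) :
    2 - 2 * fidelity ρ ρ' ≤ (101 / 100 * ε) ^ 2 := by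
  have h1 := (Real.sqrt_le_iff.1 h.2).2
  have h2 := fidelity_nonneg ρ ρ'
  by_contra hlt
  push Not at hlt
  have h3 : fidelity ρ ρ' < 1 - 51 / 100 * ε ^ 2 := by nlinarith
  have h4 : 0 < 1 - 51 / 100 * ε ^ 2 := by nlinarith
  have h5 : fidelity ρ ρ' ^ 2 < (1 - 51 / 100 * ε ^ 2) ^ 2 := by
    exact pow_lt_pow_left₀ h3 h2 two_ne_zero
  have h6 : ε ^ 2 < 1 / 36 := by nlinarith
  nlinarith [sq_nonneg ε]

lemma nonempty_message {R : ℝ} (hR : 0 ≤ R) : Nonempty (Message R) :=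
  ⟨⟨0, Nat.floor_pos.2 (Real.one_le_rpow one_le_two hR)⟩⟩

/-- The error of position-based decoding among `m ≤ r` blocks of `n ≈ 3 c / (4 δ²)` copies, for a
test with `r t c ≤ 1.1 δ⁴`. -/
lemma sqrt_le_of_copies {ε δ m r n t c p : ℝ} (hε0 : 0 ≤ ε) (hδ0 : 0 < δ) (hδ : 4 * δ ≤ 1)
    (hc : 1 ≤ c) (hn0 : 0 ≤ n) (hr : 0 ≤ r) (hm : m ≤ r) (hn : n ≤ c * 3 / (4 * δ ^ 2) + 1)
    (ht : 0 ≤ t) (hrtc : r * t * c ≤ 11 / 10 * δ ^ 4) (hp : p ≤ 2 * ε ^ 2 + 4 * (m * n * t)) :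
    √p ≤ 1415 / 1000 * ε + 19 / 10 * δ := by
  have hn' : n ≤ c * (3 / (4 * δ ^ 2) + 1) := by
    have : c * 3 / (4 * δ ^ 2) = c * (3 / (4 * δ ^ 2)) := by ring
    rw [this] at hn; linarith
  have h1 : m * n * t ≤ 143 / 160 * δ ^ 2 := by
    have h5 : δ ^ 2 ≤ 1 / 16 := by nlinarith
    calc m * n * t ≤ r * n * t := by gcongr
      _ = r * t * n := by ring
      _ ≤ r * t * (c * (3 / (4 * δ ^ 2) + 1)) := by gcongr
      _ = r * t * c * (3 / (4 * δ ^ 2) + 1) := by ring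
      _ ≤ 11 / 10 * δ ^ 4 * (3 / (4 * δ ^ 2) + 1) := by gcongr
      _ = 33 / 40 * δ ^ 2 + 11 / 10 * (δ ^ 2 * δ ^ 2) := by field_simp; ring
      _ ≤ 33 / 40 * δ ^ 2 + 11 / 10 * (δ ^ 2 * (1 / 16)) := by gcongr
      _ ≤ 143 / 160 * δ ^ 2 := by linarith [sq_nonneg δ]
  refine Real.sqrt_le_iff.2 ⟨by positivity, ?_⟩
  have h2 : 0 ≤ ε * δ := by positivity
  nlinarith [sq_nonneg ε, sq_nonneg δ]

section Main

variable {A S S' B : Type*} [Fintype A] [DecidableEq A] [Fintype S] [DecidableEq S]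
  [Fintype S'] [Fintype B] [DecidableEq B]

/-- A test for `ψ` and a bound on the max-information of a state near `ψ` yield a code. -/
theorem exists_code_of_test (N : Channel (A × S) B) {φ : S × S' → ℂ} (hφ : IsKet φ)
    {ε δ : ℝ} (hε0 : 0 < ε) (hε : 6 * ε < 1) (hδ0 : 0 < δ) (hδ : 4 * δ < 1)
    {R : ℝ} (hR0 : 0 ≤ R) {d : ℕ} {ψ : Matrix (A × (Fin d × S)) (A × (Fin d × S)) ℂ}
    (hψ : IsState ψ) (hψφ : traceFst (traceFst ψ) = traceSnd (ketbra φ))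
    {ψ' : Matrix ((A × S) × Fin d) ((A × S) × Fin d) ℂ}
    (hψ' : ψ' = ψ.submatrix (fun i => (i.1.1, (i.2, i.1.2))) (fun i => (i.1.1, (i.2, i.1.2))))
    {T : Matrix (B × Fin d) (B × Fin d) ℂ} (hT : T.PosSemidef) (hT1 : T ≤ 1)
    (hTψ : 1 - ε ^ 2 ≤ (T * ampliate N.toMap ψ').trace.re)
    {ρ' : Matrix (Fin d × S) (Fin d × S) ℂ} (hρ' : ρ' ∈ ball ε (traceFst ψ)) {l : ℝ} (hl0 : 0 ≤ l)
    (hl : ρ' ≤ ((2 : ℝ) ^ l) • (traceSnd ρ' ⊗ₖ traceFst (traceFst ψ)))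
    (hTσ : (2 : ℝ) ^ R * (T * (N.toMap (traceSnd ψ') ⊗ₖ traceFst ψ')).trace.re * 2 ^ l ≤
      11 / 10 * δ ^ 4) :
    ∃ C : Code A S' B R, IsCode N φ C (6 * ε + 4 * δ) := by
  classical
  have := nonempty_message hR0
  set ψS := traceSnd (ketbra φ) with hψS
  set σ := traceFst ψ' with hσdef
  have hψ'p : ψ'.PosSemidef := hψ' ▸ hψ.1.submatrix _
  have hσ : σ.PosSemidef := posSemidef_traceFst hψ'p
  have htr : ψ'.trace = 1 := by
    rw [← hψ.2, hψ']
    simp only [Matrix.trace, Matrix.diag, submatrix_apply, Fintype.sum_prod_type]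
    refine Finset.sum_congr rfl fun a _ => ?_
    rw [Finset.sum_comm]
  have hσ1 : σ.trace = 1 := by rw [hσdef, trace_traceFst, htr]
  obtain ⟨a₀, d₀, s₀⟩ : Nonempty (A × (Fin d × S)) := by
    by_contra hne
    rw [not_nonempty_iff] at hne
    have := hψ.2
    simp [Matrix.trace] at this
  -- A purification of `ψ`, its smoothing, and the purification with the marginal restored.
  let swap : S × Fin d → Fin d × S := Prod.swap
  let U : Matrix (Fin d × S) ((A × (Fin d × S)) × A) ℂ :=
    Matrix.of fun p c => CFC.sqrt ψ (c.2, p) c.1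
  have hU : U * Uᴴ = traceFst ψ := by
    ext p q
    have h := sqrt_mul_conjTranspose hψ.1
    simp only [traceFst, of_apply]
    conv_rhs => rw [← h]
    simp only [Matrix.mul_apply, conjTranspose_apply, U, of_apply, Fintype.sum_prod_type_right]
  obtain ⟨E, hE⟩ : ∃ E : Matrix (Fin d × S) ((A × (Fin d × S)) × A) ℂ, E * Eᴴ = 1 :=
    ⟨_, embedMatrix_mul_conjTranspose (f := fun p => ((a₀, p), a₀)) fun p q h => by simpa using h⟩
  have hψDp : (traceFst ψ).PosSemidef := posSemidef_traceFst hψ.1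
  obtain ⟨V, hV, hUV⟩ := exists_purification_hsSq_sub_eq hψDp hρ'.1.1 hE hU
  rw [trace_traceFst, hψ.2, hρ'.1.2, Complex.one_re, one_add_one_eq_two] at hUV
  have hUVε : hs (U - V) ≤ 101 / 100 * ε :=
    hs_le_of_hsSq_le (by positivity) (hUV ▸ two_sub_two_mul_fidelity_le hε0 hε hρ')
  set u : Matrix (S × Fin d) ((A × (Fin d × S)) × A) ℂ := U.submatrix swap id with hu
  set v : Matrix (S × Fin d) ((A × (Fin d × S)) × A) ℂ := V.submatrix swap id with hv
  have huv : hs (u - v) = hs (U - V) := by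
    simp only [hs, hsSq, hu, hv, Matrix.sub_apply, submatrix_apply]
    congr 1
    exact Fintype.sum_equiv (Equiv.prodComm S (Fin d)) _ _ fun _ => rfl
  have huu : u * uᴴ = (traceFst ψ).submatrix swap swap := by rw [← hU]; rfl
  have hvv : v * vᴴ = ρ'.submatrix swap swap := by rw [← hV]; rfl
  have huS : traceSnd (u * uᴴ) = ψS := by rw [huu, ← hψφ]; rfl
  have hσu : traceFst (u * uᴴ) = σ := by
    rw [huu, hσdef, hψ']
    ext i j
    simp only [traceFst, of_apply, submatrix_apply, Fintype.sum_prod_type]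
    exact Finset.sum_comm
  have hregroup : regroup u * (regroup u)ᴴ = ψ' := by
    rw [hψ']
    ext p q
    conv_rhs => rw [← sqrt_mul_conjTranspose hψ.1]
    rfl
  have hψSp : ψS.PosSemidef := posSemidef_traceSnd (posSemidef_vecMulVec_self_star φ)
  have hc0 : (0 : ℝ) < 2 ^ l := Real.rpow_pos_of_pos two_pos l
  have hc1 : (1 : ℝ) ≤ 2 ^ l := Real.one_le_rpow one_le_two hl0
  have hvle : v * vᴴ ≤ ((2 : ℝ) ^ l) • (ψS ⊗ₖ traceFst (v * vᴴ)) := by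
    have h1 := (le_iff.1 hl).submatrix swap
    rw [le_iff]
    convert h1 using 1
    rw [hvv, hψφ]
    ext p q
    simp [swap, traceFst, traceSnd, mul_comm]
  obtain ⟨w, huw, hw⟩ := exists_near_purification_le hψSp hc0.le hvle
  rw [hσu] at hw
  -- Blocks of `K / (4 δ²)` copies make the convex-split error `√(K / n)` at most `2 δ`.
  set K : ℝ := 2 ^ l * 3 with hK
  set n : ℕ := ⌈K / (4 * δ ^ 2)⌉₊ with hn
  have hn0 : 0 < n := Nat.ceil_pos.2 (by positivity)
  have : Nonempty (Fin n) := ⟨⟨0, hn0⟩⟩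
  have hn0' : (0 : ℝ) < n := Nat.cast_pos.2 hn0
  have hn1 : K / (4 * δ ^ 2) ≤ n := Nat.le_ceil _
  have hn2 : (n : ℝ) ≤ K / (4 * δ ^ 2) + 1 := (Nat.ceil_lt_add_one (by positivity)).le
  have hKn : √(K / Fintype.card (Fin n)) ≤ 2 * δ := by
    rw [Fintype.card_fin]
    refine Real.sqrt_le_iff.2 ⟨by positivity, ?_⟩
    rw [div_le_iff₀ (by positivity)] at hn1 ⊢
    linarith
  obtain ⟨Lam, hL0, hL1, hLam⟩ := exists_positionDecoder (M := Message R) (J := Fin n) hT hT1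
  let H := (((Message R × Fin n → Fin d) × S') ⊕
    ((Fin d × ((A × (Fin d × S)) × A)) × (Message R × Fin n → Fin d))) ⊕
      (S × (Message R × Fin n → Fin d))
  choose Em hEm hEmle using fun m : Message R => exists_encoder (H := H) a₀ d₀
    (f₁ := fun x => Sum.inl (Sum.inl x)) (Sum.inl_injective.comp Sum.inl_injective)
    (f₂ := fun x => Sum.inl (Sum.inr x)) (Sum.inl_injective.comp Sum.inr_injective)
    (f₃ := Sum.inr) Sum.inr_injective (g := fun j : Fin n => (m, j))
    (fun j k h => (Prod.ext_iff.1 h).2) hφ huS hσ hσ1 (by positivity) hw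
  obtain ⟨C, hC⟩ := exists_code_errorProb_le N φ
    (isKet_copiesVector (ι := Message R × Fin n) hσ hσ1) hEm hL0 hL1
  refine ⟨C, fun m => (hC m).trans ?_⟩
  have hG : (1 - Lam m).PosSemidef := by
    have : Lam m ≤ 1 :=
      (Finset.single_le_sum (fun k _ => (hL0 k).nonneg) (Finset.mem_univ m)).trans hL1
    exact le_iff.1 this
  have hG1 : 1 - Lam m ≤ 1 := by rw [sub_le_self_iff]; exact (hL0 m).nonneg
  set f := eventProb (F := Message R × Fin n → Fin d) N (1 - Lam m) with hf
  set Y := mixturePurification H σ (fun j : Fin n => (m, j)) d₀ u with hY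
  set X := sharedVector φ (copiesVector (Message R × Fin n) σ) * Em m with hX
  change f (regroup X * (regroup X)ᴴ) ≤ _
  have hstab := sqrt_le_sqrt_add_hs f (fun Z hZ => eventProb_nonneg N hG hZ)
    (fun Z hZ => eventProb_le_trace N hG1 hZ) (regroup X) (regroup Y)
  rw [← regroup_sub, hs_regroup] at hstab
  set t := (T * (N.toMap (traceSnd ψ') ⊗ₖ σ)).trace.re with ht
  have ht0 : 0 ≤ t := by
    refine re_trace_mul_nonneg hT (PosSemidef.kronecker ?_ hσ)
    rw [← traceSnd_ampliate]
    exact posSemidef_traceSnd (N.ampliate_posSemidef hψ'p)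
  have hideal : f (regroup Y * (regroup Y)ᴴ) ≤
      2 * ε ^ 2 + 4 * (Fintype.card (Message R) * n * t) := by
    rw [hY, regroup_mixturePurification_mul_conjTranspose hσ, map_smul, map_sum, hregroup]
    have h1 : ∀ j : Fin n, f (localOp ψ' σ (m, j)) ≤
        2 * ε ^ 2 + 4 * (Fintype.card (Message R) * n * t) := fun j => by
      rw [hf, eventProb_apply, ampliate_localOp]
      refine (hLam _ σ (N.ampliate_posSemidef hψ'p) hσ hσ1 m j).trans ?_
      rw [N.trace_ampliate, htr, traceSnd_ampliate, Fintype.card_fin n, Complex.one_re, ← ht]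
      linarith
    have h2 := Finset.sum_le_card_nsmul Finset.univ _ _ fun j _ => h1 j
    rw [Finset.card_univ, Fintype.card_fin, nsmul_eq_mul] at h2
    rw [Fintype.card_fin, smul_eq_mul, inv_mul_le_iff₀ hn0']
    exact h2
  have hM : (Fintype.card (Message R) : ℝ) ≤ 2 ^ R := by
    rw [Fintype.card_fin]; exact Nat.floor_le (by positivity)
  have hsq := sqrt_le_of_copies hε0.le hδ0 hδ.le hc1 (Nat.cast_nonneg _) (by positivity)
    hM hn2 ht0 hTσ hideal
  have hle := hEmle m
  rw [huv] at huw
  have hfinal : √(f (regroup X * (regroup X)ᴴ)) ≤ 6 * ε + 4 * δ := by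
    linarith
  exact (Real.sqrt_le_left (by positivity)).1 hfinal

/-- Any code meets an error bound of at least one. -/
theorem exists_code_of_one_le [Nonempty A] (N : Channel (A × S) B) {φ : S × S' → ℂ} (hφ : IsKet φ)
    {R : ℝ} (hR0 : 0 ≤ R) {η : ℝ} (hη : 1 ≤ η) : ∃ C : Code A S' B R, IsCode N φ C η := by
  classical
  have := nonempty_message hR0
  obtain ⟨a₀⟩ := ‹Nonempty A›
  obtain ⟨C, hC⟩ := exists_code_errorProb_le (EA := Unit) (EB := Unit) (r := Unit × S') (R := R) N φ
    (θ := fun _ => 1) (by simp [IsKet])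
    (E := fun _ => embedMatrix fun c => (c, a₀))
    (fun _ => embedMatrix_mul_conjTranspose fun c c' h => (Prod.ext_iff.1 h).1)
    (Lam := 0) (fun _ => PosSemidef.zero) (by simp)
  refine ⟨C, fun m => (hC m).trans (le_trans (le_of_eq ?_) (one_le_pow₀ hη))⟩
  rw [Pi.zero_apply, sub_zero, Matrix.one_mul, N.trace_ampliate, ← hsSq_eq_re_trace, hsSq_regroup,
    hsSq_mul_of_mul_conjTranspose_eq_one _
      (embedMatrix_mul_conjTranspose fun c c' h => (Prod.ext_iff.1 h).1)]
  simp only [IsKet, Fintype.sum_prod_type] at hφ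
  simpa [hsSq, sharedVector, Fintype.sum_prod_type] using hφ

end Main

/-! ### Extended real quantities -/

lemma exists_real_between_of_lt_sub {D I : EReal} {a : ℝ} (hI : ⊥ < I) (h : (a : EReal) < D - I) :
    ∃ i : ℝ, I < i ∧ ((a + i : ℝ) : EReal) < D := by
  induction I with
  | bot => exact absurd hI (lt_irrefl _)
  | top => simp at h
  | coe x =>
    induction D with
    | bot => simp at h
    | top => exact ⟨x + 1, by exact_mod_cast lt_add_one x, EReal.coe_lt_top _⟩
    | coe y =>
      have h' : a < y - x := by exact_mod_cast h
      exact ⟨x + (y - x - a) / 2, by exact_mod_cast (by linarith), by exact_mod_cast (by linarith)⟩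

lemma le_rpow_neg_of_lt_logInv {x a : ℝ} (hx : 0 ≤ x) (h : (a : EReal) < logInv x) :
    x ≤ 2 ^ (-a) := by
  rcases hx.eq_or_lt with rfl | hx
  · positivity
  · rw [logInv, if_neg hx.ne', EReal.coe_lt_coe_iff,
      Real.lt_logb_iff_rpow_lt one_lt_two (by positivity), lt_div_iff₀ hx] at h
    rw [Real.rpow_neg two_pos.le, ← one_div, le_div_iff₀ (by positivity), mul_comm]
    exact h.le

/-- The exponent in an operator inequality between states is nonnegative. -/
lemma nonneg_of_le_rpow_smul {n : Type*} [Fintype n] {ρ ω : Matrix n n ℂ} (hρ : ρ.trace = 1)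
    (hω : ω.trace = 1) {l : ℝ} (h : ρ ≤ ((2 : ℝ) ^ l) • ω) : 0 ≤ l := by
  have h1 := re_trace_le_of_le h
  rw [trace_smul, hρ, hω, Complex.smul_re, Complex.one_re, smul_eq_mul, mul_one] at h1
  by_contra hl
  push Not at hl
  exact absurd h1 (not_le.2 (Real.rpow_lt_one_of_one_lt_of_neg one_lt_two hl))

end QInfo

theorem theorem5 {A S S' B : Type*} [Fintype A] [DecidableEq A] [Fintype S] [DecidableEq S]
    [Fintype S'] [Fintype B] [DecidableEq B]
    (N : QInfo.Channel (A × S) B) (φ : S × S' → ℂ) (hφ : QInfo.IsKet φ)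
    (ε δ : ℝ) (hε0 : 0 < ε) (hε1 : ε < 1) (hδ0 : 0 < δ) (hδ1 : δ < 1)
    (R : ℝ) (hR0 : 0 ≤ R)
    (hR : (R : EReal) ≤
      QInfo.sideInformationRate N φ ε - ((4 * Real.logb 2 (1 / δ) : ℝ) : EReal)) :
    ∃ C : QInfo.Code A S' B R, QInfo.IsCode N φ C (6 * ε + 4 * δ) := by
  open QInfo in
  set L : ℝ := 4 * Real.logb 2 (1 / δ) with hL
  -- The slack `ξ` makes up for suprema and infima that are not attained.
  set ξ : ℝ := Real.logb 2 (11 / 10) with hξ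
  have hξ0 : 0 < ξ := Real.logb_pos one_lt_two (by norm_num)
  have hlt : ((R + L - ξ : ℝ) : EReal) < sideInformationRate N φ ε := by
    have h1 : ((R + L : ℝ) : EReal) ≤ sideInformationRate N φ ε := by
      rw [EReal.coe_add]
      exact (EReal.le_sub_iff_add_le (by simp) (by simp)).1 hR
    refine lt_of_lt_of_le ?_ h1
    exact_mod_cast (by linarith : R + L - ξ < R + L)
  rw [sideInformationRate] at hlt
  simp only [lt_iSup_iff] at hlt
  obtain ⟨d, ψ, ⟨hψ, hψφ⟩, hlt⟩ := hlt
  have hψD : (traceFst (traceFst ψ)).trace = 1 := by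
    rw [trace_traceFst, trace_traceFst, hψ.2]
  have hstate : ∀ ρ' ∈ ball ε (traceFst ψ), ∀ l : ℝ,
      (((2 : ℝ) ^ l) • (traceSnd ρ' ⊗ₖ traceFst (traceFst ψ)) - ρ').PosSemidef → 0 ≤ l := by
    intro ρ' hρ' l hl
    refine nonneg_of_le_rpow_smul hρ'.1.2 ?_ (Matrix.le_iff.2 hl)
    rw [Matrix.trace_kronecker, trace_traceSnd, hρ'.1.2, hψD, one_mul]
  have hbot : ⊥ < smoothMaxInformation ε (traceFst ψ) := by
    refine lt_of_lt_of_le (EReal.bot_lt_coe 0) (le_iInf₂ fun ρ' hρ' => le_iInf₂ fun l hl => ?_)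
    exact_mod_cast hstate ρ' hρ' l hl
  obtain ⟨i, hi, hDi⟩ := exists_real_between_of_lt_sub hbot hlt
  simp only [smoothMaxInformation, maxRelativeEntropy, iInf_lt_iff] at hi
  obtain ⟨ρ', hρ', l, hl, hli⟩ := hi
  simp only [hypothesisTesting, lt_iSup_iff] at hDi
  obtain ⟨T, ⟨hT, hT1, hTψ⟩, hlog⟩ := hDi
  have hA : Nonempty A := by
    by_contra hne
    rw [not_nonempty_iff] at hne
    have := hψ.2
    simp [Matrix.trace] at this
  rcases le_or_gt 1 (6 * ε + 4 * δ) with h1 | h1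
  · exact exists_code_of_one_le N hφ hR0 h1
  refine exists_code_of_test N hφ hε0 (by linarith) hδ0 (by linarith) hR0 hψ hψφ rfl hT
    (Matrix.le_iff.2 hT1) hTψ hρ' (hstate ρ' hρ' l hl) (Matrix.le_iff.2 hl) ?_
  have hψ'p := hψ.1.submatrix fun i : (A × S) × Fin d => (i.1.1, (i.2, i.1.2))
  have ht0 : 0 ≤ (T * (N.toMap (traceSnd (ψ.submatrix
      (fun i : (A × S) × Fin d => (i.1.1, (i.2, i.1.2))) fun i => (i.1.1, (i.2, i.1.2)))) ⊗ₖ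
        traceFst (ψ.submatrix (fun i : (A × S) × Fin d => (i.1.1, (i.2, i.1.2)))
          fun i => (i.1.1, (i.2, i.1.2))))).trace.re := by
    refine re_trace_mul_nonneg hT (Matrix.PosSemidef.kronecker ?_ (posSemidef_traceFst hψ'p))
    rw [← traceSnd_ampliate]
    exact posSemidef_traceSnd (N.ampliate_posSemidef hψ'p)
  have ht := le_rpow_neg_of_lt_logInv ht0 hlog
  have hli' : l < i := by exact_mod_cast hli
  have hpow : (2 : ℝ) ^ R * 2 ^ (-(R + L - ξ + i)) * 2 ^ l ≤ 11 / 10 * δ ^ 4 := by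
    have e1 : (2 : ℝ) ^ ξ = 11 / 10 := Real.rpow_logb two_pos (by norm_num) (by norm_num)
    have e2 : (2 : ℝ) ^ (-L) = δ ^ 4 := by
      have : -L = Real.logb 2 (δ ^ 4) := by
        rw [hL, one_div, Real.logb_inv, Real.logb_pow]; push_cast; ring
      rw [this, Real.rpow_logb two_pos (by norm_num) (by positivity)]
    rw [← e1, ← e2, ← Real.rpow_add two_pos, ← Real.rpow_add two_pos, ← Real.rpow_add two_pos]
    exact Real.rpow_le_rpow_of_exponent_le one_le_two (by linarith)
  refine le_trans ?_ hpow
  gcongr
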